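/- Let $K_0(x)=\int_0^\infty e^{-x\cosh t}\,dt$ ($x>0$) be the modified Bessel function of the second kind of order $0$, $\zeta$ the Riemann zeta function and $\psi=\Gamma'/\Gamma$ the digamma function. Let $0<a\le b$ with $a<2\pi$ and $b<2\pi$, and for integers $m,n\ge 0$ put \[ t_{m,n}=\frac{(-1)^m a^m (b/2)^{2n}}{m!\,(n!)^2}\Bigl\{\zeta'(-2n-m)+\zeta(-2n-m)\bigl(\psi(n+1)-\log (b/2)\bigr)\Bigr\}. \] Then the sum $\sum_{n\ge1}e^{-an}K_0(bn)$ converges and \[ \sum_{n=1}^\infty e^{-an}K_0(bn)=\sum_{m,n\ge 0}t_{m,n}+ \begin{cases}\dfrac{\pi/2-\arcsin(a/b)}{b\sqrt{1-(a/b)^2}} & (a<b),\\[2ex] \dfrac1b & (a=b).\end{cases} \] Here the double series is understood as an iterated series, in either order: both $\sum_{m\ge0}\bigl(\sum_{n\ge0}t_{m,n}\bigr)$ and $\sum_{n\ge0}\bigl(\sum_{m\ge0}t_{m,n}\bigr)$ have absolutely convergent inner and outer series, and the formula holds with each of them. If moreover $a+b<2\pi$, then the family $(t_{m,n})_{m,n\ge0}$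 is absolutely summable, so that the formula also holds with the double series as an unordered sum over all pairs $(m,n)$. -/

import Mathlib

/-- The modified Bessel function of the second kind `K_ν(x)`, for real order `ν` and `x > 0`:
`K_ν(x) = ∫_0^∞ exp(-x cosh t) cosh(ν t) dt`. -/
noncomputable def besselK (ν x : ℝ) : ℝ :=
  ∫ t in Set.Ioi (0 : ℝ), Real.exp (-x * Real.cosh t) * Real.cosh (ν * t)

/-- The `(m, n)` term of the double series:
`(-1)^m a^m (b/2)^(2n) / (m! (n!)^2) * (ζ'(-2n-m) + ζ(-2n-m) (ψ(n+1) - log (b/2)))`. -/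
noncomputable def doubleTerm (a b : ℝ) (m n : ℕ) : ℂ :=
  (-1) ^ m * (a : ℂ) ^ m * ((b : ℂ) / 2) ^ (2 * n) /
      ((m.factorial : ℂ) * (n.factorial : ℂ) ^ 2) *
    (deriv riemannZeta (-2 * (n : ℂ) - (m : ℂ)) +
      riemannZeta (-2 * (n : ℂ) - (m : ℂ)) *
        (Complex.digamma ((n : ℂ) + 1) - ((Real.log (b / 2) : ℝ) : ℂ)))

/-- The closed-form term: `(π/2 - arcsin (a/b)) / (b √(1 - (a/b)^2))` if `a < b`,
and `1/b` if `a = b` (only used for `0 < a ≤ b`). -/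
noncomputable def arcsinTerm (a b : ℝ) : ℝ :=
  if a < b then (Real.pi / 2 - Real.arcsin (a / b)) / (b * Real.sqrt (1 - (a / b) ^ 2))
  else 1 / b

open MeasureTheory Set Filter Topology Asymptotics

/-! Summing a geometric series under the integral sign turns the Bessel sum into `∫_0^∞ dt / (e^{a +
b cosh t} - 1)`. Subtracting `∫_0^∞ dt / (a + b cosh t)`, which is the closed-form term, leaves
`∫_0^∞ g(a + b cosh t) dt` with `g(z) = 1/(e^z - 1) - 1/z` (`planckReg`). This `g` is holomorphic in
the disc of radius `2π` about every real point.

For a smooth decaying `f`, the function `u(x) = ∫_0^∞ f(x cosh t) dt` satisfies `(x u')' = x ∫_0^∞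
f''(x cosh t) dt`. Together with the behaviour of `u` and `x u'` at `0`, this forces a Frobenius
expansion with logarithms (`hasSum_frobTerm`). Its coefficients are `f^(2n)(0)` and `-∫ f^(2n+1)(y)
log y dy`. The remainder is bounded by integrating the equation twice per step
(`mul_norm_coshMoment_sub_frobPartial_le`), and Cauchy estimates make it tend to zero for `x < 2π`.

For `f = g^(m)` the coefficients are values of `ζ` and `ζ'` at negative integers. They are read off
at `s = 1` from the Mellin transform of `g^(j+1)` and its derivative
(`iteratedDeriv_planckReg_zero`, `neg_integral_iteratedDeriv_planckReg_mul_log`). So `doubleTerm a b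
m n` is `a^m/m!` times the `n`-th Frobenius term of `g^(m)` (`doubleTerm_eq`).

The two iterated sums are two routes to the same integral. One expands `g(a + b cosh t)` by Taylor
in `a` and then each coefficient by Frobenius in `b`. The other applies Frobenius to `g(a + ·)` and
expands its coefficients by Taylor in `a`. Each expansion involves only one of `a`, `b`, hence the
separate conditions `a < 2π` and `b < 2π`. Joint absolute summability reduces to a binomial series
converging for `a + b < 2π`. -/

/-! ### Integrals `∫ cosh(t)^p f(b cosh t) dt` and the radial wave equation. -/

lemma inv_cosh_le_two_mul_exp_neg (t : ℝ) : (Real.cosh t)⁻¹ ≤ 2 * Real.exp (-1 * t) := by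
  rw [inv_le_comm₀ (Real.cosh_pos t) (by positivity), Real.cosh_eq, neg_one_mul, mul_inv,
    ← Real.exp_neg, neg_neg]
  nlinarith [Real.exp_pos (-t)]

/-- The integral `∫_0^∞ cosh(t)^p f(b cosh t) dt`. -/
noncomputable def coshMoment (p : ℕ) (f : ℝ → ℂ) (b : ℝ) : ℂ :=
  ∫ t in Ioi (0 : ℝ), (Real.cosh t ^ p : ℝ) • f (b * Real.cosh t)

/-- Decay of `f` one order better than the power of `cosh` leaves a single factor `1/cosh t`, hence
a dominating exponential. -/
lemma norm_coshPow_smul_le {p : ℕ} {f : ℝ → ℂ} {C b : ℝ} (hb : 0 < b)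
    (hf : ∀ x, 0 < x → ‖f x‖ ≤ C / x ^ (p + 1)) (t : ℝ) :
    ‖(Real.cosh t ^ p : ℝ) • f (b * Real.cosh t)‖ ≤
      C / b ^ (p + 1) * (2 * Real.exp (-1 * t)) := by
  have hc := Real.cosh_pos t
  have hC : 0 ≤ C := by
    have := (norm_nonneg _).trans (hf 1 one_pos)
    simpa using this
  calc ‖(Real.cosh t ^ p : ℝ) • f (b * Real.cosh t)‖
      = Real.cosh t ^ p * ‖f (b * Real.cosh t)‖ := by
        rw [norm_smul, Real.norm_of_nonneg (by positivity)]
    _ ≤ Real.cosh t ^ p * (C / (b * Real.cosh t) ^ (p + 1)) := by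
        gcongr
        exact hf _ (by positivity)
    _ = C / b ^ (p + 1) * (Real.cosh t)⁻¹ := by
        rw [mul_pow, pow_succ (Real.cosh t)]
        field_simp
    _ ≤ _ := by
        gcongr
        exact inv_cosh_le_two_mul_exp_neg t

lemma continuous_coshPow_smul {p : ℕ} {f : ℝ → ℂ} (hf : ContinuousOn f (Ioi 0)) {b : ℝ}
    (hb : 0 < b) : Continuous fun t => (Real.cosh t ^ p : ℝ) • f (b * Real.cosh t) := by
  refine (Real.continuous_cosh.pow p).smul ?_
  exact hf.comp_continuous (by fun_prop) fun t => mul_pos hb (Real.cosh_pos t)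

lemma integrableOn_coshPow_smul {p : ℕ} {f : ℝ → ℂ} (hf : ContinuousOn f (Ioi 0)) {C b : ℝ}
    (hb : 0 < b) (hC : ∀ x, 0 < x → ‖f x‖ ≤ C / x ^ (p + 1)) :
    IntegrableOn (fun t => (Real.cosh t ^ p : ℝ) • f (b * Real.cosh t)) (Ioi 0) := by
  refine Integrable.mono' (((exp_neg_integrableOn_Ioi 0 one_pos).const_mul 2).const_mul
    (C / b ^ (p + 1))) (continuous_coshPow_smul hf hb).aestronglyMeasurable ?_
  exact ae_of_all _ fun t => norm_coshPow_smul_le hb hC t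

lemma norm_coshMoment_le {p : ℕ} {f : ℝ → ℂ} {C b : ℝ}
    (hb : 0 < b) (hC : ∀ x, 0 < x → ‖f x‖ ≤ C / x ^ (p + 1)) :
    ‖coshMoment p f b‖ ≤ 2 * C / b ^ (p + 1) := by
  refine (norm_integral_le_of_norm_le (((exp_neg_integrableOn_Ioi 0 one_pos).const_mul 2).const_mul
    (C / b ^ (p + 1))) (ae_of_all _ fun t => norm_coshPow_smul_le hb hC t)).trans_eq ?_
  rw [integral_const_mul, integral_const_mul]
  simp only [neg_one_mul]
  rw [integral_exp_neg_Ioi_zero]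
  ring

lemma hasDerivAt_coshMoment {p : ℕ} {f f' : ℝ → ℂ} {C C' b : ℝ}
    (hf : ∀ x, 0 < x → HasDerivAt f (f' x) x) (hf' : ContinuousOn f' (Ioi 0))
    (hC : ∀ x, 0 < x → ‖f x‖ ≤ C / x ^ (p + 1))
    (hC' : ∀ x, 0 < x → ‖f' x‖ ≤ C' / x ^ (p + 2)) (hb : 0 < b) :
    HasDerivAt (coshMoment p f) (coshMoment (p + 1) f' b) b := by
  have hfc : ContinuousOn f (Ioi 0) := fun x hx => (hf x hx).continuousAt.continuousWithinAt
  have hC0 : 0 ≤ C' := by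
    have := (norm_nonneg _).trans (hC' 1 one_pos)
    simpa using this
  refine (hasDerivAt_integral_of_dominated_loc_of_deriv_le (s := Ioi (b / 2))
    (μ := volume.restrict (Ioi (0 : ℝ)))
    (bound := fun t => C' / (b / 2) ^ (p + 2) * (2 * Real.exp (-1 * t)))
    (F := fun x t => (Real.cosh t ^ p : ℝ) • f (x * Real.cosh t))
    (F' := fun x t => (Real.cosh t ^ (p + 1) : ℝ) • f' (x * Real.cosh t))
    (Ioi_mem_nhds (by linarith)) ?_ (integrableOn_coshPow_smul hfc hb hC)
    (continuous_coshPow_smul hf' hb).aestronglyMeasurable ?_ ?_ ?_).2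
  · filter_upwards [Ioi_mem_nhds hb] with x hx
    exact (continuous_coshPow_smul hfc hx).aestronglyMeasurable
  · refine ae_of_all _ fun t x hx => ?_
    have hx0 : 0 < x := lt_trans (by linarith) (mem_Ioi.1 hx)
    refine (norm_coshPow_smul_le (p := p + 1) hx0 hC' t).trans ?_
    have : b / 2 ≤ x := (mem_Ioi.1 hx).le
    gcongr
  · exact ((exp_neg_integrableOn_Ioi 0 one_pos).const_mul 2).const_mul _
  · refine ae_of_all _ fun t x hx => ?_
    have hx0 : 0 < x := lt_trans (by linarith) (mem_Ioi.1 hx)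
    have h1 : HasDerivAt (fun x : ℝ => x * Real.cosh t) (Real.cosh t) x := by
      simpa using (hasDerivAt_id x).mul_const (Real.cosh t)
    have := ((hf _ (mul_pos hx0 (Real.cosh_pos t))).scomp x h1).const_smul (Real.cosh t ^ p)
    exact this.congr_deriv (by rw [pow_succ, mul_smul])

lemma tendsto_cosh_atTop : Tendsto Real.cosh atTop atTop := by
  refine tendsto_atTop_mono (fun t => ?_)
    ((Real.tendsto_exp_atTop).const_mul_atTop (show (0 : ℝ) < 1 / 2 by norm_num))
  rw [Real.cosh_eq]
  nlinarith [Real.exp_pos (-t)]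

lemma abs_sinh_le_cosh (t : ℝ) : |Real.sinh t| ≤ Real.cosh t := by
  rw [← Real.cosh_abs, Real.abs_sinh]
  exact (Real.sinh_lt_cosh _).le

/-- The radial wave equation: `(b I_{f}'(b))' = b I_{f''}(b)`. -/
lemma hasDerivAt_mul_coshMoment_one {f f' : ℝ → ℂ} {C C' b : ℝ}
    (hf : ∀ x, 0 < x → HasDerivAt f (f' x) x) (hf' : ContinuousOn f' (Ioi 0))
    (hC : ∀ x, 0 < x → ‖f x‖ ≤ C / x ^ 2)
    (hC' : ∀ x, 0 < x → ‖f' x‖ ≤ C' / x ^ 3) (hC0 : ∀ x, 0 < x → ‖f' x‖ ≤ C' / x) (hb : 0 < b) :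
    HasDerivAt (fun x : ℝ => (x : ℂ) * coshMoment 1 f x) (b * coshMoment 0 f' b) b := by
  have hfc : ContinuousOn f (Ioi 0) := fun x hx => (hf x hx).continuousAt.continuousWithinAt
  have h1 := (hasDerivAt_id b).ofReal_comp.mul
    (hasDerivAt_coshMoment (p := 1) hf hf' hC hC' hb)
  have i1 := integrableOn_coshPow_smul (p := 1) hfc hb hC
  have i2 := integrableOn_coshPow_smul (p := 2) hf' hb hC'
  have i0 := integrableOn_coshPow_smul (p := 0) hf' hb (by simpa using hC0)
  -- The integrand is the total derivative of `sinh t · f(b cosh t)`, using `sinh² = cosh² - 1`.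
  -- Both boundary terms vanish.
  have key : ∫ t in Ioi (0 : ℝ), ((Real.cosh t ^ 1 : ℝ) • f (b * Real.cosh t) +
      ((b : ℂ) * ((Real.cosh t ^ 2 : ℝ) • f' (b * Real.cosh t)) -
        (b : ℂ) * ((Real.cosh t ^ 0 : ℝ) • f' (b * Real.cosh t)))) =
      0 - Real.sinh 0 • f (b * Real.cosh 0) := by
    refine integral_Ioi_of_hasDerivAt_of_tendsto
      (f := fun t => Real.sinh t • f (b * Real.cosh t)) ?_ ?_
      (i1.add ((i2.const_mul _).sub (i0.const_mul _))) ?_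
    · have := hfc.comp_continuous (f := fun t => b * Real.cosh t) (by fun_prop)
        fun t => mul_pos hb (Real.cosh_pos t)
      exact (Real.continuous_sinh.smul this).continuousWithinAt
    · intro t _
      have h2 : HasDerivAt (fun t : ℝ => b * Real.cosh t) (b * Real.sinh t) t :=
        (Real.hasDerivAt_cosh t).const_mul b
      have := (Real.hasDerivAt_sinh t).smul
        ((hf _ (mul_pos hb (Real.cosh_pos t))).scomp t h2)
      refine this.congr_deriv ?_
      have h3 : (Real.cosh t : ℂ) ^ 2 = (Real.sinh t : ℂ) ^ 2 + 1 := by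
        exact_mod_cast Real.cosh_sq t
      simp only [Complex.real_smul, Function.comp_def]
      push_cast at h3 ⊢
      linear_combination (-(b : ℂ) * f' (b * Real.cosh t)) * h3
    · have h4 : Tendsto (fun t : ℝ => C / b ^ 2 * (Real.cosh t)⁻¹) atTop (𝓝 0) := by
        simpa using (tendsto_inv_atTop_zero.comp tendsto_cosh_atTop).const_mul (C / b ^ 2)
      refine squeeze_zero_norm (fun t => ?_) h4
      have hc := Real.cosh_pos t
      rw [norm_smul, Real.norm_eq_abs]
      calc |Real.sinh t| * ‖f (b * Real.cosh t)‖
          ≤ Real.cosh t * (C / (b * Real.cosh t) ^ 2) :=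
            mul_le_mul (abs_sinh_le_cosh t) (hC _ (by positivity)) (norm_nonneg _) hc.le
        _ = C / b ^ 2 * (Real.cosh t)⁻¹ := by field_simp
  have e1 := integral_add i1 ((i2.const_mul (b : ℂ)).sub (i0.const_mul (b : ℂ)))
  have e2 := integral_sub (i2.const_mul (b : ℂ)) (i0.const_mul (b : ℂ))
  simp only [Pi.sub_apply] at e1
  rw [e1, e2, integral_const_mul, integral_const_mul] at key
  simp only [Real.sinh_zero, zero_smul, sub_zero] at key
  refine h1.congr_deriv ?_
  simp only [coshMoment, id, Complex.ofReal_one, one_mul, Nat.reduceAdd]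
  linear_combination key

/-- With `sinh` in place of `cosh` the integrand `x sinh t · f'(x cosh t)` is an exact derivative
and integrates to `-f(x)`. Since `cosh t - sinh t = e^{-t}`, the replacement costs at most `C x`. -/
lemma tendsto_mul_coshMoment_one {f f' : ℝ → ℂ} {C : ℝ}
    (hf : ∀ x, 0 < x → HasDerivAt f (f' x) x) (hf0 : ContinuousWithinAt f (Ioi 0) 0)
    (hf' : ContinuousOn f' (Ioi 0))
    (hC : ∀ x, 0 < x → ‖f x‖ ≤ C / x) (hC2 : ∀ x, 0 < x → ‖f' x‖ ≤ C / x ^ 2)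
    (hC0 : ∀ x, 0 < x → ‖f' x‖ ≤ C) :
    Tendsto (fun x : ℝ => (x : ℂ) * coshMoment 1 f' x) (𝓝[>] 0) (𝓝 (-f 0)) := by
  have hfc : ContinuousOn f (Ioi 0) := fun x hx => (hf x hx).continuousAt.continuousWithinAt
  have bound : ∀ x : ℝ, 0 < x → ‖(x : ℂ) * coshMoment 1 f' x + f x‖ ≤ C * x := by
    intro b hb
    have i1 := (integrableOn_coshPow_smul (p := 1) hf' hb hC2).const_mul (b : ℂ)
    have hcomp : Continuous fun t => f' (b * Real.cosh t) :=
      hf'.comp_continuous (by fun_prop) fun t => mul_pos hb (Real.cosh_pos t)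
    have bd : ∀ t, ‖(b : ℂ) * (Real.exp (-1 * t) • f' (b * Real.cosh t))‖ ≤
        C * b * Real.exp (-1 * t) := fun t => by
      rw [norm_mul, norm_smul, Complex.norm_real, Real.norm_of_nonneg hb.le,
        Real.norm_of_nonneg (Real.exp_pos _).le]
      have := hC0 (b * Real.cosh t) (mul_pos hb (Real.cosh_pos t))
      calc b * (Real.exp (-1 * t) * ‖f' (b * Real.cosh t)‖)
          ≤ b * (Real.exp (-1 * t) * C) := by gcongr
        _ = _ := by ring
    have i2 : IntegrableOn (fun t => (b : ℂ) * (Real.exp (-1 * t) • f' (b * Real.cosh t)))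
        (Ioi 0) := by
      refine Integrable.mono' ((exp_neg_integrableOn_Ioi 0 one_pos).const_mul (C * b)) ?_
        (ae_of_all _ bd)
      exact (continuous_const.mul ((by fun_prop : Continuous fun t : ℝ => Real.exp (-1 * t)).smul hcomp)).aestronglyMeasurable
    have key : ∫ t in Ioi (0 : ℝ), ((b : ℂ) * ((Real.cosh t ^ 1 : ℝ) • f' (b * Real.cosh t)) -
        (b : ℂ) * (Real.exp (-1 * t) • f' (b * Real.cosh t))) = 0 - f (b * Real.cosh 0) := by
      refine integral_Ioi_of_hasDerivAt_of_tendsto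
        (f := fun t => f (b * Real.cosh t)) ?_ ?_ (i1.sub i2) ?_
      · exact (hfc.comp_continuous (f := fun t => b * Real.cosh t) (by fun_prop)
          fun t => mul_pos hb (Real.cosh_pos t)).continuousWithinAt
      · intro t _
        have h2 : HasDerivAt (fun t : ℝ => b * Real.cosh t) (b * Real.sinh t) t :=
          (Real.hasDerivAt_cosh t).const_mul b
        have := (hf _ (mul_pos hb (Real.cosh_pos t))).scomp t h2
        refine this.congr_deriv ?_
        have h3 : (Real.cosh t : ℂ) - Real.exp (-1 * t) = Real.sinh t := by
          rw [neg_one_mul, ← Complex.ofReal_sub, ← Real.cosh_sub_sinh]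
          congr 1
          ring
        simp only [Complex.real_smul, pow_one, Complex.ofReal_mul, ← h3]
        ring
      · have h4 : Tendsto (fun t : ℝ => C / b * (Real.cosh t)⁻¹) atTop (𝓝 0) := by
          simpa using (tendsto_inv_atTop_zero.comp tendsto_cosh_atTop).const_mul (C / b)
        refine squeeze_zero_norm (fun t => ?_) h4
        have hc := Real.cosh_pos t
        refine (hC _ (mul_pos hb hc)).trans_eq (by field_simp)
    rw [integral_sub i1 i2, integral_const_mul] at key
    have e : (b : ℂ) * coshMoment 1 f' b + f b =
        ∫ t in Ioi (0 : ℝ), (b : ℂ) * (Real.exp (-1 * t) • f' (b * Real.cosh t)) := by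
      rw [Real.cosh_zero, mul_one] at key
      simp only [coshMoment]
      linear_combination key
    rw [e]
    refine (norm_integral_le_of_norm_le ((exp_neg_integrableOn_Ioi 0 one_pos).const_mul (C * b))
      (ae_of_all _ bd)).trans_eq ?_
    rw [integral_const_mul]
    simp only [neg_one_mul]
    rw [integral_exp_neg_Ioi_zero, mul_one]
  have t0 : Tendsto (fun x : ℝ => (x : ℂ) * coshMoment 1 f' x + f x) (𝓝[>] 0) (𝓝 0) := by
    refine squeeze_zero_norm' (eventually_nhdsWithin_of_forall fun x hx => bound x hx) ?_
    have : Tendsto (fun x : ℝ => C * x) (𝓝 0) (𝓝 (C * 0)) := tendsto_id.const_mul C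
    rw [mul_zero] at this
    exact this.mono_left nhdsWithin_le_nhds
  simpa using t0.sub hf0.tendsto

/-! ### Logarithmic behaviour of `∫ f(x cosh t) dt` as `x → 0`. -/

lemma integrableOn_abs_log_div_one_add_sq :
    IntegrableOn (fun y : ℝ => |Real.log y| / (1 + y) ^ 2) (Ioi 0) := by
  have hm : Measurable fun y : ℝ => |Real.log y| / (1 + y) ^ 2 := by
    have : Measurable fun y : ℝ => |Real.log y| := Real.measurable_log.abs
    fun_prop
  rw [← Ioc_union_Ioi_eq_Ioi zero_le_one]
  refine IntegrableOn.union ?_ ?_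
  · have h1 : IntegrableOn Real.log (Ioc 0 1) :=
      (intervalIntegrable_iff_integrableOn_Ioc_of_le zero_le_one).1
        intervalIntegral.intervalIntegrable_log'
    refine Integrable.mono' h1.norm hm.aestronglyMeasurable ?_
    refine (ae_restrict_iff' measurableSet_Ioc).2 (ae_of_all _ fun y hy => ?_)
    rw [Real.norm_of_nonneg (by positivity), Real.norm_eq_abs]
    exact div_le_self (abs_nonneg _) (one_le_pow₀ (by linarith [hy.1]))
  · have h2 : IntegrableOn (fun y : ℝ => 2 * y ^ (-(3 / 2) : ℝ)) (Ioi 1) :=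
      (integrableOn_Ioi_rpow_of_lt (by norm_num) one_pos).const_mul 2
    refine Integrable.mono' h2 hm.aestronglyMeasurable ?_
    refine (ae_restrict_iff' measurableSet_Ioi).2 (ae_of_all _ fun y hy => ?_)
    have hy1 : (1 : ℝ) < y := hy
    have hy0 : 0 < y := one_pos.trans hy1
    rw [Real.norm_of_nonneg (by positivity), abs_of_nonneg (Real.log_nonneg hy1.le)]
    have h3 := Real.log_le_rpow_div hy0.le (show (0 : ℝ) < 1 / 2 by norm_num)
    calc Real.log y / (1 + y) ^ 2 ≤ (y ^ (1 / 2 : ℝ) / (1 / 2)) / y ^ 2 := by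
          gcongr
          linarith
      _ = 2 * y ^ (-(3 / 2) : ℝ) := by
          rw [show (-(3 / 2) : ℝ) = 1 / 2 - (2 : ℕ) by norm_num, Real.rpow_sub hy0,
            Real.rpow_natCast]
          ring

lemma integrableOn_mul_log {f : ℝ → ℂ} {C : ℝ} (hf : ContinuousOn f (Ioi 0))
    (hC : ∀ x, 0 < x → ‖f x‖ ≤ C / (1 + x) ^ 2) :
    IntegrableOn (fun y => f y * (Real.log y : ℂ)) (Ioi 0) := by
  refine Integrable.mono' (integrableOn_abs_log_div_one_add_sq.const_mul C) ?_ ?_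
  · refine ContinuousOn.aestronglyMeasurable ?_ measurableSet_Ioi
    refine hf.mul (Complex.continuous_ofReal.comp_continuousOn ?_)
    exact Real.continuousOn_log.mono fun x hx => (ne_of_gt hx : x ≠ 0)
  · refine (ae_restrict_iff' measurableSet_Ioi).2 (ae_of_all _ fun y hy => ?_)
    rw [norm_mul, Complex.norm_real, Real.norm_eq_abs]
    calc ‖f y‖ * |Real.log y| ≤ C / (1 + y) ^ 2 * |Real.log y| := by
          gcongr
          exact hC y hy
      _ = _ := by ring

lemma norm_sub_le_of_deriv_bound {f f' : ℝ → ℂ} {C : ℝ}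
    (hf : ∀ x, 0 < x → HasDerivAt f (f' x) x) (hC : ∀ x, 0 < x → ‖f' x‖ ≤ C) {x y : ℝ}
    (hx : 0 < x) (hy : 0 < y) : ‖f y - f x‖ ≤ C * ‖y - x‖ :=
  (convex_Ioi (0 : ℝ)).norm_image_sub_le_of_norm_hasDerivWithin_le
    (fun z hz => (hf z hz).hasDerivWithinAt) hC hx hy

/-- Substituting `y = ε e^t` gives `∫_ε^∞ f(y) dy/y`, which is then integrated by parts against `log
y`. -/
lemma integral_comp_mul_exp_eq {f f' : ℝ → ℂ} {C ε : ℝ}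
    (hf : ∀ x, 0 < x → HasDerivAt f (f' x) x) (hf' : ContinuousOn f' (Ioi 0))
    (hC : ∀ x, 0 < x → ‖f x‖ ≤ C / (1 + x)) (hC' : ∀ x, 0 < x → ‖f' x‖ ≤ C / (1 + x) ^ 2)
    (hε : 0 < ε) :
    IntegrableOn (fun t => f (ε * Real.exp t)) (Ioi 0) ∧
    ∫ t in Ioi (0 : ℝ), f (ε * Real.exp t) =
      -(∫ y in Ioi ε, f' y * (Real.log y : ℂ)) - (Real.log ε : ℂ) * f ε := by
  have hfc : ContinuousOn f (Ioi 0) := fun x hx => (hf x hx).continuousAt.continuousWithinAt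
  have hC0 : 0 ≤ C := by
    have := (norm_nonneg _).trans (hC 1 one_pos)
    rw [le_div_iff₀ (by norm_num)] at this
    simpa using this
  have sub : Ioi ε ⊆ Ioi 0 := Ioi_subset_Ioi hε.le
  have hcomp : Continuous fun t => f (ε * Real.exp t) :=
    hfc.comp_continuous (by fun_prop) fun t => mul_pos hε (Real.exp_pos t)
  have i0 : IntegrableOn (fun t => f (ε * Real.exp t)) (Ici 0) := by
    rw [integrableOn_Ici_iff_integrableOn_Ioi]
    refine Integrable.mono' ((exp_neg_integrableOn_Ioi 0 one_pos).const_mul (C / ε))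
      hcomp.aestronglyMeasurable (ae_of_all _ fun t => ?_)
    have hp : 0 < ε * Real.exp t := mul_pos hε (Real.exp_pos t)
    calc ‖f (ε * Real.exp t)‖ ≤ C / (1 + ε * Real.exp t) := hC _ hp
      _ ≤ C / (ε * Real.exp t) := by
        gcongr
        linarith
      _ = C / ε * Real.exp (-1 * t) := by
        rw [neg_one_mul, Real.exp_neg]
        field_simp
  refine ⟨i0.mono_set Ioi_subset_Ici_self, ?_⟩
  have ig : IntegrableOn (fun y => f y * ((y⁻¹ : ℝ) : ℂ)) (Ioi ε) := by
    refine Integrable.mono' ((integrableOn_Ioi_rpow_of_lt (show (-2 : ℝ) < -1 by norm_num)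
      hε).const_mul C) ?_ ((ae_restrict_iff' measurableSet_Ioi).2 (ae_of_all _ fun y hy => ?_))
    · refine ContinuousOn.aestronglyMeasurable ?_ measurableSet_Ioi
      refine (hfc.mono sub).mul (Complex.continuous_ofReal.comp_continuousOn ?_)
      exact continuousOn_inv₀.mono fun x hx => (ne_of_gt (sub hx) : x ≠ 0)
    · have hy0 : 0 < y := sub hy
      rw [norm_mul, Complex.norm_real, Real.norm_of_nonneg (inv_nonneg.2 hy0.le)]
      calc ‖f y‖ * y⁻¹ ≤ C / y * y⁻¹ := by
            gcongr
            refine (hC y hy0).trans ?_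
            gcongr
            linarith
        _ = C * y ^ (-2 : ℝ) := by
            rw [Real.rpow_neg hy0.le, Real.rpow_two]
            field_simp
  have img : (fun t => ε * Real.exp t) '' Ici 0 ⊆ Ici ε := by
    rintro _ ⟨t, ht, rfl⟩
    have := Real.one_le_exp (mem_Ici.1 ht)
    exact mem_Ici.2 (by nlinarith)
  have e1 := integral_deriv_smul_comp_Ioi (f := fun t => ε * Real.exp t)
    (f' := fun t => ε * Real.exp t) (g := fun y => f y * ((y⁻¹ : ℝ) : ℂ)) (a := 0)
    (by fun_prop) (Real.tendsto_exp_atTop.const_mul_atTop hε)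
    (fun x _ => ((Real.hasDerivAt_exp x).const_mul ε).hasDerivWithinAt)
    (by
      refine ContinuousOn.mono (s := Ioi 0) ?_ ?_
      · refine hfc.mul (Complex.continuous_ofReal.comp_continuousOn ?_)
        exact continuousOn_inv₀.mono fun x hx => (ne_of_gt hx : x ≠ 0)
      · rintro _ ⟨t, _, rfl⟩
        exact mul_pos hε (Real.exp_pos t))
    (((integrableOn_Ici_iff_integrableOn_Ioi enorm_ne_top).2 ig).mono_set img)
    (by
      refine i0.congr_fun (fun t _ => ?_) measurableSet_Ici
      have : (ε * Real.exp t : ℂ) ≠ 0 := by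
        exact_mod_cast (mul_pos hε (Real.exp_pos t)).ne'
      simp only [Function.comp, Complex.real_smul]
      have h' : (ε : ℂ) ≠ 0 := by exact_mod_cast hε.ne'
      push_cast at this ⊢
      field_simp)
  have e2 : ∫ t in Ioi (0 : ℝ), f (ε * Real.exp t) = ∫ y in Ioi ε, f y * ((y⁻¹ : ℝ) : ℂ) := by
    rw [Real.exp_zero, mul_one] at e1
    rw [← e1]
    refine setIntegral_congr_fun measurableSet_Ioi fun t _ => ?_
    have : (ε * Real.exp t : ℂ) ≠ 0 := by
      exact_mod_cast (mul_pos hε (Real.exp_pos t)).ne'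
    simp only [Function.comp, Complex.real_smul]
    have h' : (ε : ℂ) ≠ 0 := by exact_mod_cast hε.ne'
    push_cast at this ⊢
    field_simp
  have ilog := (integrableOn_mul_log hf' hC').mono_set sub
  have if' : IntegrableOn f' (Ioi ε) := by
    refine Integrable.mono' ((integrableOn_Ioi_rpow_of_lt (show (-2 : ℝ) < -1 by norm_num)
      hε).const_mul C) ((hf'.mono sub).aestronglyMeasurable measurableSet_Ioi)
      ((ae_restrict_iff' measurableSet_Ioi).2 (ae_of_all _ fun y hy => ?_))
    have hy0 : 0 < y := sub hy
    refine (hC' y hy0).trans ?_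
    rw [Real.rpow_neg hy0.le, Real.rpow_two, div_eq_mul_inv]
    gcongr
    linarith
  have tf : Tendsto f atTop (𝓝 0) := by
    refine squeeze_zero_norm' (eventually_atTop.2 ⟨1, fun x hx => (hC x (by linarith)).trans
      (?_ : _ ≤ C * x⁻¹)⟩) (by simpa using tendsto_inv_atTop_zero.const_mul C)
    rw [div_eq_mul_inv]
    gcongr
    linarith
  have tlog : Tendsto (fun y => f y * (Real.log y : ℂ)) atTop (𝓝 0) := by
    have h := (Real.isLittleO_log_id_atTop.tendsto_div_nhds_zero).abs.const_mul C
    rw [abs_zero, mul_zero] at h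
    refine squeeze_zero_norm' (eventually_atTop.2 ⟨1, fun x hx => ?_⟩) h
    have hx0 : (0 : ℝ) < x := by linarith
    rw [norm_mul, Complex.norm_real, Real.norm_eq_abs, abs_div, id, abs_of_pos hx0]
    calc ‖f x‖ * |Real.log x| ≤ C / x * |Real.log x| := by
          gcongr
          refine (hC x hx0).trans ?_
          gcongr
          linarith
      _ = _ := by ring
  have e3 : ∫ y in Ioi ε, (f' y * (Real.log y : ℂ) + f y * ((y⁻¹ : ℝ) : ℂ)) =
      0 - f ε * (Real.log ε : ℂ) := by
    refine integral_Ioi_of_hasDerivAt_of_tendsto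
      (f := fun y => f y * (Real.log y : ℂ)) ?_ ?_ (ilog.add ig) tlog
    · refine ContinuousAt.continuousWithinAt ((hf ε hε).continuousAt.mul ?_)
      exact Complex.continuous_ofReal.continuousAt.comp (Real.continuousAt_log hε.ne')
    · intro y hy
      exact (hf y (sub hy)).mul (Real.hasDerivAt_log (ne_of_gt (sub hy))).ofReal_comp
  rw [integral_add ilog ig] at e3
  rw [e2]
  linear_combination e3

/-- Since `x cosh t - (x/2) e^t = (x/2) e^{-t}` and `f` is Lipschitz, `cosh t` may be replaced by
`e^t/2` with error `O(x)`. The substitution formula with `ε = x/2` then produces `log (x/2)`, and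
`log ε · (f ε - f 0)` tends to zero. -/
lemma tendsto_coshMoment_zero_add_log {f f' : ℝ → ℂ} {C : ℝ}
    (hf : ∀ x, 0 < x → HasDerivAt f (f' x) x) (hf0 : ContinuousWithinAt f (Ioi 0) 0)
    (hf' : ContinuousOn f' (Ioi 0))
    (hC : ∀ x, 0 < x → ‖f x‖ ≤ C / (1 + x)) (hC' : ∀ x, 0 < x → ‖f' x‖ ≤ C / (1 + x) ^ 2) :
    Tendsto (fun x : ℝ => coshMoment 0 f x + f 0 * (Real.log (x / 2) : ℂ)) (𝓝[>] 0)
      (𝓝 (-∫ y in Ioi (0 : ℝ), f' y * (Real.log y : ℂ))) := by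
  have hfc : ContinuousOn f (Ioi 0) := fun x hx => (hf x hx).continuousAt.continuousWithinAt
  have hC0 : 0 ≤ C := by
    have := (norm_nonneg _).trans (hC 1 one_pos)
    rw [le_div_iff₀ (by norm_num)] at this
    simpa using this
  have hCb : ∀ x, 0 < x → ‖f' x‖ ≤ C := fun x hx =>
    (hC' x hx).trans (div_le_self hC0 (one_le_pow₀ (by linarith)))
  have hhalf : Tendsto (fun x : ℝ => x / 2) (𝓝[>] 0) (𝓝[>] 0) := by
    refine tendsto_nhdsWithin_iff.2 ⟨?_, eventually_nhdsWithin_of_forall fun x hx =>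
      half_pos (mem_Ioi.1 hx)⟩
    have : Tendsto (fun x : ℝ => x / 2) (𝓝 0) (𝓝 (0 / 2)) := tendsto_id.div_const 2
    rw [zero_div] at this
    exact this.mono_left nhdsWithin_le_nhds
  have tA : Tendsto (fun x : ℝ => coshMoment 0 f x -
      ∫ t in Ioi (0 : ℝ), f (x / 2 * Real.exp t)) (𝓝[>] 0) (𝓝 0) := by
    have h0 : Tendsto (fun x : ℝ => C * (x / 2)) (𝓝[>] 0) (𝓝 0) := by
      simpa using (tendsto_nhds_of_tendsto_nhdsWithin hhalf).const_mul C
    refine squeeze_zero_norm' (eventually_nhdsWithin_of_forall fun x hx => ?_) h0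
    have hx0 : (0 : ℝ) < x := hx
    have i1 := integrableOn_coshPow_smul (p := 0) (C := C) hfc hx0 fun y hy =>
      (hC y hy).trans (by rw [zero_add, pow_one]; gcongr; linarith)
    have i2 := (integral_comp_mul_exp_eq hf hf' hC hC' (half_pos hx0)).1
    rw [coshMoment, ← integral_sub i1 i2]
    refine (norm_integral_le_of_norm_le ((exp_neg_integrableOn_Ioi 0 one_pos).const_mul
      (C * (x / 2))) (ae_of_all _ fun t => ?_)).trans_eq ?_
    · rw [pow_zero, one_smul]
      refine (norm_sub_le_of_deriv_bound hf hCb (mul_pos (half_pos hx0) (Real.exp_pos t))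
        (mul_pos hx0 (Real.cosh_pos t))).trans_eq ?_
      have : x * Real.cosh t - x / 2 * Real.exp t = x / 2 * Real.exp (-1 * t) := by
        rw [Real.cosh_eq, neg_one_mul]
        ring
      rw [this, Real.norm_of_nonneg (by positivity)]
      ring
    · rw [integral_const_mul]
      simp only [neg_one_mul]
      rw [integral_exp_neg_Ioi_zero, mul_one]
  have tB : Tendsto (fun x : ℝ => ∫ y in Ioi (x / 2), f' y * (Real.log y : ℂ)) (𝓝[>] 0)
      (𝓝 (∫ y in Ioi (0 : ℝ), f' y * (Real.log y : ℂ))) := by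
    have h := (aecover_Ioi_of_Ioi (μ := volume)
      (tendsto_nhds_of_tendsto_nhdsWithin hhalf)).integral_tendsto_of_countably_generated
      (integrableOn_mul_log hf' hC')
    refine h.congr' (eventually_nhdsWithin_of_forall fun x hx => ?_)
    rw [Measure.restrict_restrict measurableSet_Ioi, Ioi_inter_Ioi,
      sup_eq_left.2 (half_pos (mem_Ioi.1 hx)).le]
  have tC : Tendsto (fun x : ℝ => (Real.log (x / 2) : ℂ) * (f (x / 2) - f 0)) (𝓝[>] 0)
      (𝓝 0) := by
    have h := ((tendsto_log_mul_rpow_nhdsGT_zero one_pos).comp hhalf).abs.const_mul C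
    rw [abs_zero, mul_zero] at h
    refine squeeze_zero_norm' (eventually_nhdsWithin_of_forall fun x hx => ?_) h
    have hx0 : 0 < x / 2 := half_pos (mem_Ioi.1 hx)
    have hb : ‖f (x / 2) - f 0‖ ≤ C * (x / 2) := by
      refine le_of_tendsto (f := fun y => ‖f (x / 2) - f y‖) (x := 𝓝[>] (0 : ℝ))
        (tendsto_const_nhds.sub hf0.tendsto).norm ?_
      filter_upwards [Ioo_mem_nhdsGT hx0] with y hy
      refine (norm_sub_le_of_deriv_bound hf hCb hy.1 hx0).trans ?_
      rw [Real.norm_of_nonneg (by linarith [hy.2])]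
      gcongr
      linarith [hy.1]
    simp only [Function.comp, Real.rpow_one, abs_mul, abs_of_pos hx0, norm_mul,
      Complex.norm_real, Real.norm_eq_abs]
    calc |Real.log (x / 2)| * ‖f (x / 2) - f 0‖ ≤ |Real.log (x / 2)| * (C * (x / 2)) := by gcongr
      _ = _ := by ring
  have := (tA.sub tB).sub tC
  rw [zero_sub, sub_zero] at this
  refine this.congr' (eventually_nhdsWithin_of_forall fun x hx => ?_)
  rw [(integral_comp_mul_exp_eq hf hf' hC hC' (half_pos (mem_Ioi.1 hx))).2]
  ring

/-! ### Frobenius terms and the Bessel operator. -/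

/-- The Frobenius term `(x/2)^(2n) / n!^2 * (c₀ (H_n - log (x/2)) + c₁)`. -/
noncomputable def frobTerm (c₀ c₁ : ℂ) (n : ℕ) (x : ℝ) : ℂ :=
  (((x / 2) ^ (2 * n) / (n.factorial : ℝ) ^ 2 : ℝ) : ℂ) *
    (c₀ * (((harmonic n : ℝ) - Real.log (x / 2) : ℝ) : ℂ) + c₁)

/-- In terms of coefficients, `x d/dx` acts on the `n`-th term by `(c₀, c₁) ↦ (2n c₀, 2n c₁ - c₀)`.
-/
lemma hasDerivAt_frobTerm (c₀ c₁ : ℂ) (n : ℕ) {x : ℝ} (hx : 0 < x) :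
    HasDerivAt (frobTerm c₀ c₁ n) ((x : ℂ)⁻¹ * frobTerm (2 * n * c₀) (2 * n * c₁ - c₀) n x) x := by
  have hx0 : (x : ℂ) ≠ 0 := by exact_mod_cast hx.ne'
  have h1 : HasDerivAt (fun y : ℝ => (y / 2) ^ (2 * n) / (n.factorial : ℝ) ^ 2)
      (x⁻¹ * (2 * n * ((x / 2) ^ (2 * n) / (n.factorial : ℝ) ^ 2))) x := by
    have := (((hasDerivAt_id x).div_const 2).pow (2 * n)).div_const ((n.factorial : ℝ) ^ 2)
    refine this.congr_deriv ?_
    rcases n with _ | n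
    · simp
    · rw [show 2 * (n + 1) - 1 = 2 * n + 1 by omega, show 2 * (n + 1) = 2 * n + 1 + 1 by omega,
        pow_succ _ (2 * n + 1)]
      simp only [id]
      push_cast
      field_simp
      ring
  have h2 : HasDerivAt (fun y : ℝ => (harmonic n : ℝ) - Real.log (y / 2)) (-x⁻¹) x := by
    have := (((hasDerivAt_id x).div_const 2).log (by simpa using hx.ne')).const_sub
      (harmonic n : ℝ)
    refine this.congr_deriv ?_
    simp only [id]
    field_simp
  refine (h1.ofReal_comp.mul ((h2.ofReal_comp.const_mul c₀).add_const c₁)).congr_deriv ?_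
  simp only [frobTerm]
  push_cast
  ring

/-- Applying `x d/dx` twice and dividing by `x` lowers the index by one and leaves `(c₀, c₁)`
unchanged. The cross term `-4(n+1) c₀` cancels against `H_{n+1} - H_n = 1/(n+1)`, which is why
harmonic numbers occur in the terms. -/
lemma inv_mul_frobTerm_succ (c₀ c₁ : ℂ) (n : ℕ) {x : ℝ} (hx : 0 < x) :
    (x : ℂ)⁻¹ * frobTerm (2 * (n + 1 : ℕ) * (2 * (n + 1 : ℕ) * c₀))
      (2 * (n + 1 : ℕ) * (2 * (n + 1 : ℕ) * c₁ - c₀) - 2 * (n + 1 : ℕ) * c₀) (n + 1) x =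
      x * frobTerm c₀ c₁ n x := by
  have hx0 : (x : ℂ) ≠ 0 := by exact_mod_cast hx.ne'
  have hn : ((n : ℂ) + 1) ≠ 0 := by exact_mod_cast n.succ_ne_zero
  have hf : (n.factorial : ℂ) ≠ 0 := by exact_mod_cast n.factorial_ne_zero
  simp only [frobTerm, harmonic_succ, Nat.factorial_succ]
  rw [show 2 * (n + 1) = 2 * n + 2 by omega, pow_add]
  push_cast
  field_simp
  ring

lemma tendsto_frobTerm_succ (c₀ c₁ : ℂ) (n : ℕ) :
    Tendsto (frobTerm c₀ c₁ (n + 1)) (𝓝[>] 0) (𝓝 0) := by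
  have hhalf : Tendsto (fun x : ℝ => x / 2) (𝓝[>] 0) (𝓝[>] 0) := by
    refine tendsto_nhdsWithin_iff.2 ⟨?_, eventually_nhdsWithin_of_forall fun x hx =>
      half_pos (mem_Ioi.1 hx)⟩
    have : Tendsto (fun x : ℝ => x / 2) (𝓝 0) (𝓝 (0 / 2)) := tendsto_id.div_const 2
    rw [zero_div] at this
    exact this.mono_left nhdsWithin_le_nhds
  have hp : (0 : ℝ) < (2 * (n + 1) : ℕ) := by positivity
  have t1 := (tendsto_log_mul_rpow_nhdsGT_zero hp).comp hhalf
  have t2 : Tendsto (fun x : ℝ => (x / 2) ^ (2 * (n + 1))) (𝓝[>] 0) (𝓝 0) := by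
    have := (tendsto_nhds_of_tendsto_nhdsWithin hhalf).pow (2 * (n + 1))
    simpa using this
  have t3 := ((t2.ofReal.mul_const (c₀ * (harmonic (n + 1) : ℂ) + c₁)).sub
    (t1.ofReal.mul_const c₀)).div_const ((n + 1).factorial ^ 2 : ℂ)
  simp only [Complex.ofReal_zero, zero_mul, sub_zero, zero_div] at t3
  refine t3.congr' (eventually_nhdsWithin_of_forall fun x hx => ?_)
  simp only [Function.comp, frobTerm, Real.rpow_natCast]
  push_cast
  ring

/-- The mean value inequality is applied on `[ε, x]` and `ε → 0` afterwards, so only a limit at `0`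
is required and no differentiability there. -/
lemma norm_le_of_deriv_norm_le_pow {f f' : ℝ → ℂ} {c : ℝ} (hc : 0 ≤ c) {p : ℕ}
    (hf : ∀ x, 0 < x → HasDerivAt f (f' x) x) (h0 : Tendsto f (𝓝[>] 0) (𝓝 0))
    (hf' : ∀ x, 0 < x → ‖f' x‖ ≤ c * (p + 1) * x ^ p) {x : ℝ} (hx : 0 < x) :
    ‖f x‖ ≤ c * x ^ (p + 1) := by
  have key : ∀ ε ∈ Ioo 0 x, ‖f x - f ε‖ ≤ c * x ^ (p + 1) := by
    intro ε hε
    refine image_norm_le_of_norm_deriv_right_le_deriv_boundary (f := fun y => f y - f ε)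
      (f' := f') (a := ε) (b := x) (B := fun y => c * y ^ (p + 1))
      (B' := fun y => c * (p + 1) * y ^ p) ?_ ?_ ?_ ?_ ?_ (right_mem_Icc.2 hε.2.le)
    · exact fun y hy => ((hf y (hε.1.trans_le hy.1)).continuousAt.sub
        continuousAt_const).continuousWithinAt
    · exact fun y hy => ((hf y (hε.1.trans_le hy.1)).sub_const _).hasDerivWithinAt
    · have := hε.1
      simp only [sub_self, norm_zero]
      positivity
    · intro y
      refine ((hasDerivAt_pow (p + 1) y).const_mul c).congr_deriv ?_
      push_cast
      ring
    · exact fun y hy => hf' y (hε.1.trans_le hy.1)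
  have : Tendsto (fun ε => ‖f x - f ε‖) (𝓝[>] 0) (𝓝 ‖f x - 0‖) := (h0.const_sub (f x)).norm
  rw [sub_zero] at this
  refine le_of_tendsto this ?_
  filter_upwards [Ioo_mem_nhdsGT hx] with ε hε using key ε hε

/-- Partial sums of the Frobenius expansion of `∫_0^∞ F_k(x cosh t) dt` around `x = 0`. -/
noncomputable def frobPartial (F : ℕ → ℝ → ℂ) (N k : ℕ) (x : ℝ) : ℂ :=
  ∑ n ∈ Finset.range N, frobTerm (F (k + 2 * n) 0)
    (-∫ y in Ioi (0 : ℝ), F (k + 2 * n + 1) y * (Real.log y : ℂ)) n x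

/-- The product of the first `N` odd numbers. -/
def oddProd (N : ℕ) : ℕ := ∏ i ∈ Finset.range N, (2 * i + 1)

lemma oddProd_pos (N : ℕ) : 0 < oddProd N := Finset.prod_pos fun _ _ => Nat.succ_pos _

lemma oddProd_succ (N : ℕ) : oddProd (N + 1) = oddProd N * (2 * N + 1) :=
  Finset.prod_range_succ _ _

/-! ### The Frobenius expansion and its remainder. -/

section Expansion

variable {F : ℕ → ℝ → ℂ} {M : ℕ → ℝ}

lemma exists_common_decay
    (hdec : ∀ e k, e ≤ k → ∃ C, ∀ x, 0 < x → ‖F k x‖ ≤ C / (1 + x) ^ (e + 1)) (k : ℕ) :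
    ∃ C, 0 ≤ C ∧ (∀ x, 0 < x → ‖F k x‖ ≤ C / (1 + x)) ∧
      (∀ x, 0 < x → ‖F (k + 1) x‖ ≤ C / (1 + x) ^ 2) ∧
      (∀ x, 0 < x → ‖F (k + 2) x‖ ≤ C / (1 + x) ^ 3) := by
  obtain ⟨C0, h0⟩ := hdec 0 k (by omega)
  obtain ⟨C1, h1⟩ := hdec 1 (k + 1) (by omega)
  obtain ⟨C2, h2⟩ := hdec 2 (k + 2) (by omega)
  refine ⟨|C0| + |C1| + |C2|, by positivity, fun x hx => (h0 x hx).trans ?_,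
    fun x hx => (h1 x hx).trans ?_, fun x hx => (h2 x hx).trans ?_⟩
  · rw [zero_add, pow_one]
    gcongr
    linarith [le_abs_self C0, abs_nonneg C1, abs_nonneg C2]
  · gcongr
    linarith [le_abs_self C1, abs_nonneg C0, abs_nonneg C2]
  · gcongr
    linarith [le_abs_self C2, abs_nonneg C0, abs_nonneg C1]

/-- Here `E = x R'` for the remainder `R` of order `N + 1` at level `k`, and `(x R')'` is `x` times
the remainder of order `N` at level `k + 2`. The `n = 0` term is killed by the operator, and its two
coefficients are exactly those making `R` and `x R'` vanish at `0`. -/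
lemma hasDerivAt_coshMoment_sub_frobPartial
    (hF : ∀ k x, 0 ≤ x → HasDerivAt (F k) (F (k + 1) x) x)
    (hdec : ∀ e k, e ≤ k → ∃ C, ∀ x, 0 < x → ‖F k x‖ ≤ C / (1 + x) ^ (e + 1)) (N k : ℕ) :
    ∃ E : ℝ → ℂ, (∀ x : ℝ, 0 < x → HasDerivAt
        (fun x => coshMoment 0 (F k) x - frobPartial F (N + 1) k x) ((x : ℂ)⁻¹ * E x) x) ∧
      (∀ x : ℝ, 0 < x → HasDerivAt E
        (x * (coshMoment 0 (F (k + 2)) x - frobPartial F N (k + 2) x)) x) ∧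
      Tendsto (fun x => coshMoment 0 (F k) x - frobPartial F (N + 1) k x) (𝓝[>] 0) (𝓝 0) ∧
      Tendsto E (𝓝[>] 0) (𝓝 0) := by
  obtain ⟨C, hC, h0, h1, h2⟩ := exists_common_decay hdec k
  have hc : ∀ k, ContinuousOn (F k) (Ioi 0) := fun k x hx =>
    (hF k x (mem_Ioi.1 hx).le).continuousAt.continuousWithinAt
  have hd : ∀ k x, 0 < x → HasDerivAt (F k) (F (k + 1) x) x := fun k x hx => hF k x hx.le
  have b0 : ∀ x, 0 < x → ‖F k x‖ ≤ C / x := fun x hx => (h0 x hx).trans (by gcongr; linarith)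
  have b1 : ∀ x, 0 < x → ‖F (k + 1) x‖ ≤ C / x ^ 2 := fun x hx =>
    (h1 x hx).trans (by gcongr; linarith)
  have b10 : ∀ x, 0 < x → ‖F (k + 1) x‖ ≤ C := fun x hx =>
    (h1 x hx).trans (div_le_self hC (one_le_pow₀ (by linarith)))
  have b2 : ∀ x, 0 < x → ‖F (k + 2) x‖ ≤ C / x ^ 3 := fun x hx =>
    (h2 x hx).trans (by gcongr; linarith)
  have b20 : ∀ x, 0 < x → ‖F (k + 2) x‖ ≤ C / x := fun x hx =>
    (h2 x hx).trans (by
      gcongr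
      calc x ≤ (1 + x) ^ 1 := by linarith
        _ ≤ (1 + x) ^ 3 := pow_le_pow_right₀ (by linarith) (by norm_num))
  set c₀ : ℕ → ℂ := fun n => F (k + 2 * n) 0 with hc₀
  set c₁ : ℕ → ℂ := fun n => -∫ y in Ioi (0 : ℝ), F (k + 2 * n + 1) y * (Real.log y : ℂ) with hc₁
  refine ⟨fun x => x * coshMoment 1 (F (k + 1)) x - ∑ n ∈ Finset.range (N + 1),
    frobTerm (2 * n * c₀ n) (2 * n * c₁ n - c₀ n) n x, fun x hx => ?_, fun x hx => ?_, ?_, ?_⟩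
  · have hx0 : (x : ℂ) ≠ 0 := by exact_mod_cast hx.ne'
    have hs := HasDerivAt.fun_sum (u := Finset.range (N + 1)) (x := x)
      fun n _ => hasDerivAt_frobTerm (c₀ n) (c₁ n) n hx
    have := (hasDerivAt_coshMoment (p := 0) (hd k) (hc _) (by simpa using b0) b1 hx).sub hs
    refine this.congr_deriv ?_
    rw [← Finset.mul_sum, mul_sub, ← mul_assoc, inv_mul_cancel₀ hx0, one_mul]
  · have hs := HasDerivAt.fun_sum (u := Finset.range (N + 1)) (x := x)
      fun n _ => hasDerivAt_frobTerm (2 * n * c₀ n) (2 * n * c₁ n - c₀ n) n hx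
    have := (hasDerivAt_mul_coshMoment_one (hd (k + 1)) (hc _) b1 b2 b20 hx).sub hs
    refine this.congr_deriv ?_
    rw [Finset.sum_range_succ', mul_sub (x : ℂ), frobPartial, Finset.mul_sum]
    congr 1
    -- The term `n = 0` solves the homogeneous equation, so the other terms can be reindexed by `n +
    -- 1`.
    have z : (x : ℂ)⁻¹ * frobTerm (2 * (0 : ℕ) * (2 * (0 : ℕ) * c₀ 0))
        (2 * (0 : ℕ) * (2 * (0 : ℕ) * c₁ 0 - c₀ 0) - 2 * (0 : ℕ) * c₀ 0) 0 x = 0 := by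
      simp [frobTerm]
    rw [z, add_zero]
    refine Finset.sum_congr rfl fun n _ => ?_
    rw [inv_mul_frobTerm_succ _ _ _ hx]
    simp only [hc₀, hc₁, show k + 2 * (n + 1) = k + 2 + 2 * n by ring]
  · have t := (tendsto_coshMoment_zero_add_log (hd k)
      (hF k 0 le_rfl).continuousAt.continuousWithinAt (hc (k + 1)) h0 h1).sub_const (c₁ 0)
    have ts : Tendsto (fun x => ∑ n ∈ Finset.range N, frobTerm (c₀ (n + 1)) (c₁ (n + 1)) (n + 1) x)
        (𝓝[>] 0) (𝓝 (∑ n ∈ Finset.range N, 0)) :=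
      tendsto_finsetSum _ fun n _ => tendsto_frobTerm_succ _ _ n
    have := t.sub ts
    simp only [hc₁, mul_zero, add_zero, sub_self, Finset.sum_const_zero] at this
    refine this.congr fun x => ?_
    rw [frobPartial, Finset.sum_range_succ']
    simp only [frobTerm, hc₀, mul_zero, add_zero, pow_zero, Nat.factorial_zero, Nat.cast_one,
      harmonic_zero, Rat.cast_zero]
    push_cast
    ring
  · have t := (tendsto_mul_coshMoment_one (hd k)
      (hF k 0 le_rfl).continuousAt.continuousWithinAt (hc (k + 1)) b0 b1 b10).add_const (c₀ 0)
    have ts : Tendsto (fun x => ∑ n ∈ Finset.range N, frobTerm (2 * (n + 1 : ℕ) * c₀ (n + 1))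
        (2 * (n + 1 : ℕ) * c₁ (n + 1) - c₀ (n + 1)) (n + 1) x)
        (𝓝[>] 0) (𝓝 (∑ n ∈ Finset.range N, 0)) :=
      tendsto_finsetSum _ fun n _ => tendsto_frobTerm_succ _ _ n
    have := t.sub ts
    have e : -F k 0 + c₀ 0 - ∑ n ∈ Finset.range N, (0 : ℂ) = 0 := by simp [hc₀]
    rw [e] at this
    refine this.congr fun x => ?_
    have z : frobTerm (2 * (0 : ℕ) * c₀ 0) (2 * (0 : ℕ) * c₁ 0 - c₀ 0) 0 x = -c₀ 0 := by
      simp [frobTerm]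
    rw [Finset.sum_range_succ', z]
    ring

/-- Induction on the order: two integrations from `0` each divide by `2N + 1`, which builds up the
squared product of odd numbers. With no terms subtracted, the bound is the trivial one by `2 M_k /
x`. -/
lemma mul_norm_coshMoment_sub_frobPartial_le
    (hF : ∀ k x, 0 ≤ x → HasDerivAt (F k) (F (k + 1) x) x)
    (hdec : ∀ e k, e ≤ k → ∃ C, ∀ x, 0 < x → ‖F k x‖ ≤ C / (1 + x) ^ (e + 1))
    (hM : ∀ k x, 0 < x → ‖F k x‖ ≤ M k / x) (N : ℕ) : ∀ (k : ℕ) {x : ℝ}, 0 < x →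
    x * ‖coshMoment 0 (F k) x - frobPartial F N k x‖ ≤
      2 * M (k + 2 * N) / (oddProd N : ℝ) ^ 2 * x ^ (2 * N) := by
  have hM0 : ∀ k, 0 ≤ M k := fun k => by
    have := (norm_nonneg _).trans (hM k 1 one_pos)
    simpa using this
  induction N with
  | zero =>
    intro k x hx
    have := norm_coshMoment_le (p := 0) (C := M k) hx (by simpa using hM k)
    simp only [frobPartial, Finset.range_zero, Finset.sum_empty, sub_zero, oddProd, mul_zero,
      Finset.prod_empty, Nat.cast_one, one_pow, div_one, pow_zero, mul_one, add_zero]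
    rw [zero_add, pow_one, le_div_iff₀ hx] at this
    linarith
  | succ N ih =>
    intro k x hx
    obtain ⟨E, hD, hE, tD, tE⟩ := hasDerivAt_coshMoment_sub_frobPartial hF hdec N k
    have hq : (0 : ℝ) < oddProd N := by exact_mod_cast oddProd_pos N
    have hk : k + 2 + 2 * N = k + 2 * (N + 1) := by ring
    set A : ℝ := 2 * M (k + 2 * (N + 1)) / (oddProd N : ℝ) ^ 2 with hA
    have hA0 : 0 ≤ A := by
      have := hM0 (k + 2 * (N + 1))
      positivity
    have hn : (0 : ℝ) < 2 * N + 1 := by positivity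
    have bE : ∀ y, 0 < y → ‖E y‖ ≤ A / (2 * N + 1) * y ^ (2 * N + 1) := fun y hy =>
      norm_le_of_deriv_norm_le_pow (by positivity) hE tE (fun z hz => by
        rw [norm_mul, Complex.norm_real, Real.norm_of_nonneg hz.le]
        refine (ih (k + 2) hz).trans_eq ?_
        rw [hk, ← hA]
        push_cast
        field_simp) hy
    have bD := norm_le_of_deriv_norm_le_pow (c := A / (2 * N + 1) ^ 2) (p := 2 * N)
      (by positivity) hD tD (fun z hz => by
        rw [norm_mul, norm_inv, Complex.norm_real, Real.norm_of_nonneg hz.le]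
        calc z⁻¹ * ‖E z‖ ≤ z⁻¹ * (A / (2 * N + 1) * z ^ (2 * N + 1)) := by
              gcongr
              exact bE z hz
          _ = _ := by
              rw [pow_succ]
              push_cast
              field_simp) hx
    calc x * ‖coshMoment 0 (F k) x - frobPartial F (N + 1) k x‖
        ≤ x * (A / (2 * N + 1) ^ 2 * x ^ (2 * N + 1)) := by gcongr
      _ = _ := by
        rw [oddProd_succ, hA, show 2 * (N + 1) = 2 * N + 1 + 1 by ring, pow_succ x (2 * N + 1)]
        push_cast
        field_simp

/-- A single term is the difference of two consecutive remainders, so the logarithmic integral in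
its coefficient needs no separate estimate. -/
lemma mul_norm_frobTerm_le
    (hF : ∀ k x, 0 ≤ x → HasDerivAt (F k) (F (k + 1) x) x)
    (hdec : ∀ e k, e ≤ k → ∃ C, ∀ x, 0 < x → ‖F k x‖ ≤ C / (1 + x) ^ (e + 1))
    (hM : ∀ k x, 0 < x → ‖F k x‖ ≤ M k / x) (k n : ℕ) {x : ℝ} (hx : 0 < x) :
    x * ‖frobTerm (F (k + 2 * n) 0)
      (-∫ y in Ioi (0 : ℝ), F (k + 2 * n + 1) y * (Real.log y : ℂ)) n x‖ ≤
      2 * M (k + 2 * n) / (oddProd n : ℝ) ^ 2 * x ^ (2 * n) +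
      2 * M (k + 2 * (n + 1)) / (oddProd (n + 1) : ℝ) ^ 2 * x ^ (2 * (n + 1)) := by
  have h1 := mul_norm_coshMoment_sub_frobPartial_le hF hdec hM n k hx
  have h2 := mul_norm_coshMoment_sub_frobPartial_le hF hdec hM (n + 1) k hx
  refine le_trans ?_ (add_le_add h1 h2)
  rw [← mul_add]
  gcongr
  refine le_trans (le_of_eq ?_) (norm_sub_le _ _)
  congr 1
  simp only [frobPartial, Finset.sum_range_succ]
  ring

/-- The Frobenius expansion of `∫_0^∞ F_0(x cosh t) dt` in terms of the derivatives `F_k`. -/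
theorem hasSum_frobTerm
    (hF : ∀ k x, 0 ≤ x → HasDerivAt (F k) (F (k + 1) x) x)
    (hdec : ∀ e k, e ≤ k → ∃ C, ∀ x, 0 < x → ‖F k x‖ ≤ C / (1 + x) ^ (e + 1))
    (hM : ∀ k x, 0 < x → ‖F k x‖ ≤ M k / x) {x : ℝ} (hx : 0 < x)
    (hsum : Summable fun n => M (2 * n) / (oddProd n : ℝ) ^ 2 * x ^ (2 * n)) :
    HasSum (fun n => frobTerm (F (2 * n) 0)
      (-∫ y in Ioi (0 : ℝ), F (2 * n + 1) y * (Real.log y : ℂ)) n x) (coshMoment 0 (F 0) x) := by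
  have hs : Summable fun n => 2 * M (2 * n) / (oddProd n : ℝ) ^ 2 * x ^ (2 * n) := by
    simpa only [mul_div_assoc, mul_assoc] using hsum.mul_left 2
  have s1 : Summable fun n => frobTerm (F (2 * n) 0)
      (-∫ y in Ioi (0 : ℝ), F (2 * n + 1) y * (Real.log y : ℂ)) n x := by
    refine Summable.of_norm_bounded ((hs.add ((summable_nat_add_iff 1).2 hs)).mul_left x⁻¹)
      fun n => ?_
    have := mul_norm_frobTerm_le hF hdec hM 0 n hx
    simp only [zero_add] at this
    rwa [le_inv_mul_iff₀ hx]
  rw [s1.hasSum_iff_tendsto_nat]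
  have t : Tendsto (fun N => coshMoment 0 (F 0) x - frobPartial F N 0 x) atTop (𝓝 0) := by
    have := hs.tendsto_atTop_zero.const_mul x⁻¹
    rw [mul_zero] at this
    refine squeeze_zero_norm (fun N => ?_) this
    rw [le_inv_mul_iff₀ hx]
    simpa using mul_norm_coshMoment_sub_frobPartial_le hF hdec hM N 0 hx
  have := t.const_sub (coshMoment 0 (F 0) x)
  simpa [frobPartial] using this

end Expansion

/-! ### Holomorphy and decay of `1/(e^z - 1) - 1/z`. -/

/-- The function `1/(e^z - 1)`. -/
noncomputable def planck (z : ℂ) : ℂ := (Complex.exp z - 1)⁻¹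

/-- The holomorphic extension of `1/(e^z - 1) - 1/z` across `z = 0`. -/
noncomputable def planckReg (z : ℂ) : ℂ :=
  -dslope (dslope Complex.exp 0) 0 z / dslope Complex.exp 0 z

lemma differentiable_dslope_exp : Differentiable ℂ (dslope Complex.exp 0) := by
  rw [← differentiableOn_univ]
  exact (Complex.differentiableOn_dslope univ_mem).2 Complex.differentiable_exp.differentiableOn

lemma dslope_exp_zero : dslope Complex.exp 0 0 = 1 := by simp

lemma dslope_exp_of_ne {z : ℂ} (hz : z ≠ 0) :
    dslope Complex.exp 0 z = (Complex.exp z - 1) / z := by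
  rw [dslope_of_ne _ hz, slope_def_field, Complex.exp_zero, sub_zero]

lemma planckReg_eq {z : ℂ} (hz : z ≠ 0) (hz1 : Complex.exp z ≠ 1) :
    planckReg z = planck z - z⁻¹ := by
  have h1 : Complex.exp z - 1 ≠ 0 := sub_ne_zero.2 hz1
  rw [planckReg, planck, dslope_of_ne _ hz, slope_def_field, dslope_exp_zero, dslope_exp_of_ne hz]
  field_simp
  ring

lemma differentiableAt_planckReg {z : ℂ} (hz : dslope Complex.exp 0 z ≠ 0) :
    DifferentiableAt ℂ planckReg z := by
  have h : Differentiable ℂ (dslope (dslope Complex.exp 0) 0) := by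
    rw [← differentiableOn_univ]
    exact (Complex.differentiableOn_dslope univ_mem).2
      differentiable_dslope_exp.differentiableOn
  exact (h z).neg.div (differentiable_dslope_exp z) hz

/-- The zeros of `e^z - 1` other than `0` are `2πin` with `n ≠ 0`, whose imaginary parts keep them
at distance at least `2π` from the real axis. -/
lemma exp_ne_one_of_dist_lt {u : ℝ} {z : ℂ} (hz : ‖z - u‖ < 2 * Real.pi) (hz0 : z ≠ 0) :
    Complex.exp z ≠ 1 := by
  intro h
  obtain ⟨n, rfl⟩ := Complex.exp_eq_one_iff.1 h
  have hn : n ≠ 0 := by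
    rintro rfl
    simp at hz0
  have h1 := (Complex.abs_im_le_norm _).trans_lt hz
  simp only [Complex.sub_im, Complex.mul_im, Complex.intCast_re, Complex.intCast_im,
    Complex.ofReal_im, Complex.mul_re, Complex.ofReal_re, Complex.I_im, Complex.I_re, mul_one,
    mul_zero, sub_zero, zero_mul, add_zero] at h1
  norm_num [abs_mul, abs_of_pos Real.pi_pos] at h1
  have h2 : (1 : ℝ) ≤ |(n : ℝ)| := by exact_mod_cast Int.one_le_abs hn
  nlinarith [Real.pi_pos]

lemma dslope_exp_ne_zero {u : ℝ} {z : ℂ} (hz : ‖z - u‖ < 2 * Real.pi) :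
    dslope Complex.exp 0 z ≠ 0 := by
  by_cases hz0 : z = 0
  · rw [hz0, dslope_exp_zero]
    exact one_ne_zero
  · rw [dslope_exp_of_ne hz0]
    exact div_ne_zero (sub_ne_zero.2 (exp_ne_one_of_dist_lt hz hz0)) hz0

lemma differentiableOn_planckReg_ball (u : ℝ) :
    DifferentiableOn ℂ planckReg (Metric.ball (u : ℂ) (2 * Real.pi)) := fun z hz =>
  (differentiableAt_planckReg (dslope_exp_ne_zero (u := u)
    (by rwa [Metric.mem_ball, dist_eq_norm] at hz))).differentiableWithinAt

lemma differentiableOn_iteratedDeriv_planckReg_ball (k : ℕ) (u : ℝ) :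
    DifferentiableOn ℂ (iteratedDeriv k planckReg) (Metric.ball (u : ℂ) (2 * Real.pi)) := by
  intro z hz
  have := (differentiableOn_planckReg_ball u).analyticAt (Metric.isOpen_ball.mem_nhds hz)
  rw [iteratedDeriv_eq_iterate]
  exact (this.iterated_deriv k).differentiableAt.differentiableWithinAt

lemma hasDerivAt_iteratedDeriv_planckReg (k : ℕ) (x : ℝ) :
    HasDerivAt (fun x : ℝ => iteratedDeriv k planckReg x) (iteratedDeriv (k + 1) planckReg x) x := by
  have h : DifferentiableAt ℂ (iteratedDeriv k planckReg) x :=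
    (differentiableOn_iteratedDeriv_planckReg_ball k x).differentiableAt
      (Metric.ball_mem_nhds _ Real.two_pi_pos)
  rw [iteratedDeriv_succ]
  exact h.hasDerivAt.comp_ofReal

lemma hasSum_taylor_planckReg (k : ℕ) (x : ℝ) {s : ℝ} (hs : |s| < 2 * Real.pi) :
    HasSum (fun m : ℕ => (s : ℂ) ^ m / (m.factorial : ℂ) * iteratedDeriv (k + m) planckReg x)
      (iteratedDeriv k planckReg ((s + x : ℝ) : ℂ)) := by
  have := Complex.hasSum_taylorSeries_on_ball (differentiableOn_iteratedDeriv_planckReg_ball k x)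
    (z := ((s + x : ℝ) : ℂ)) (by simpa using hs)
  refine this.congr_fun fun m => ?_
  rw [iteratedDeriv_eq_iterate, iteratedDeriv_eq_iterate, iteratedDeriv_eq_iterate, add_comm k m,
    Function.iterate_add_apply]
  simp only [smul_eq_mul]
  push_cast
  ring

lemma exists_bound_planckReg {r : ℝ} (hr : r < 2 * Real.pi) (R : ℝ) :
    ∃ C, 0 ≤ C ∧ ∀ u ∈ Icc 0 R, ∀ z : ℂ, ‖z - (u : ℂ)‖ ≤ r → ‖planckReg z‖ ≤ C := by
  have hK : IsCompact ((fun p : ℝ × ℂ => (p.1 : ℂ) + p.2) ''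
      (Icc 0 R ×ˢ Metric.closedBall (0 : ℂ) r)) :=
    (isCompact_Icc.prod (isCompact_closedBall _ _)).image (by fun_prop)
  obtain ⟨C, hC⟩ := hK.exists_bound_of_continuousOn (f := planckReg) (by
    rintro _ ⟨⟨u, w⟩, ⟨_, hw⟩, rfl⟩
    refine (differentiableAt_planckReg
      (dslope_exp_ne_zero (u := u) ?_)).continuousAt.continuousWithinAt
    simpa using (mem_closedBall_zero_iff.1 hw).trans_lt hr)
  refine ⟨max C 0, le_max_right _ _, fun u hu z hz => (hC z ?_).trans (le_max_left _ _)⟩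
  exact ⟨(u, z - u), ⟨hu, mem_closedBall_zero_iff.2 hz⟩, by simp⟩

/-- Cauchy's estimate on the circle of radius `r` about `x`. There `Re z ≥ x - r ≥ 1` gives `|e^z -
1| ≥ e^{x-r}/2`, which dominates any power of `1 + x`. -/
lemma norm_iteratedDeriv_planck_le {r : ℝ} (hr : 0 < r) (e : ℕ) :
    ∃ C, 0 ≤ C ∧ ∀ (j : ℕ) (x : ℝ), r + 1 ≤ x →
      ‖iteratedDeriv j planck x‖ ≤
        C * j.factorial / r ^ j / (1 + x) ^ (e + 1) := by
  refine ⟨2 * (e + 1).factorial * (2 + r) ^ (e + 1), by positivity, fun j x hx => ?_⟩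
  have hre : ∀ z ∈ Metric.closedBall (x : ℂ) r, x - r ≤ z.re := fun z hz => by
    rw [Metric.mem_closedBall, dist_eq_norm] at hz
    have := (Complex.abs_re_le_norm _).trans hz
    simp only [Complex.sub_re, Complex.ofReal_re] at this
    linarith [(abs_le.1 this).1]
  have hbig : ∀ z ∈ Metric.closedBall (x : ℂ) r,
      Real.exp (x - r) / 2 ≤ ‖Complex.exp z - 1‖ := fun z hz => by
    have h1 : Real.exp (x - r) ≤ Real.exp z.re := Real.exp_le_exp.2 (hre z hz)
    have h2 := norm_sub_norm_le (Complex.exp z) 1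
    rw [Complex.norm_exp, norm_one] at h2
    have h3 := Real.add_one_le_exp (x - r)
    linarith
  have hne : ∀ z ∈ Metric.closedBall (x : ℂ) r, Complex.exp z - 1 ≠ 0 := fun z hz => by
    have := (half_pos (Real.exp_pos (x - r))).trans_le (hbig z hz)
    exact norm_pos_iff.1 this
  have hd : DifferentiableOn ℂ planck (Metric.closedBall (x : ℂ) r) :=
    fun z hz => ((Complex.differentiable_exp z).sub_const 1).fun_inv (hne z hz)
      |>.differentiableWithinAt
  refine (Complex.norm_iteratedDeriv_le_of_forall_mem_sphere_norm_le
    (C := 2 * (e + 1).factorial * (2 + r) ^ (e + 1) / (1 + x) ^ (e + 1)) j hr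
    (hd.diffContOnCl_ball Subset.rfl) fun z hz => ?_).trans_eq (by ring)
  have hz' := Metric.sphere_subset_closedBall hz
  have h4 := Real.pow_div_factorial_le_exp (x - r) (by linarith) (e + 1)
  -- The constant `2 + r` is the value of `1 + x` at the endpoint `x = r + 1`, where `x - r = 1`.
  have h5 : ((1 + x) / (2 + r)) ^ (e + 1) ≤ (x - r) ^ (e + 1) := by
    have : 0 ≤ 1 + x := by linarith
    gcongr
    rw [div_le_iff₀ (by linarith)]
    nlinarith
  have h6 : ((1 + x) / (2 + r)) ^ (e + 1) / (e + 1).factorial / 2 ≤ ‖Complex.exp z - 1‖ := by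
    refine le_trans ?_ (hbig z hz')
    gcongr
    exact (div_le_div_of_nonneg_right h5 (by positivity)).trans h4
  have h7 : 0 < 1 + x := by linarith
  rw [planck, norm_inv]
  refine (inv_anti₀ (by positivity) h6).trans_eq ?_
  rw [div_pow]
  field_simp

lemma exp_ne_one_of_pos {x : ℝ} (hx : 0 < x) : Complex.exp x ≠ 1 :=
  exp_ne_one_of_dist_lt (u := x) (by simp [Real.pi_pos]) (by exact_mod_cast hx.ne')

lemma iteratedDeriv_planckReg_eq (j : ℕ) {x : ℝ} (hx : 0 < x) :
    iteratedDeriv j planckReg x =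
      iteratedDeriv j planck x - (-1) ^ j * (j.factorial : ℂ) * (x : ℂ) ^ (-1 - (j : ℤ)) := by
  have hxc : (x : ℂ) ≠ 0 := by exact_mod_cast hx.ne'
  have hex := exp_ne_one_of_pos hx
  have hev : planckReg =ᶠ[𝓝 (x : ℂ)] planck - Inv.inv := by
    filter_upwards [isOpen_ne.mem_nhds hxc,
      Complex.continuous_exp.continuousAt.eventually_ne hex] with z hz hz1
    exact planckReg_eq hz hz1
  have a1 : AnalyticAt ℂ planck x :=
    (analyticAt_cexp.sub analyticAt_const).fun_inv (sub_ne_zero.2 hex)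
  have a2 : AnalyticAt ℂ (Inv.inv : ℂ → ℂ) x := analyticAt_inv hxc
  rw [hev.iteratedDeriv_eq, iteratedDeriv_sub a1.contDiffAt a2.contDiffAt]
  congr 1
  rw [iteratedDeriv_eq_iterate, iter_deriv_inv]

/-- Cauchy estimates with polynomial decay for the derivatives of `1/(e^x - 1) - 1/x`. -/
lemma norm_iteratedDeriv_planckReg_le {r : ℝ} (hr : 0 < r) (hr' : r < 2 * Real.pi) (e : ℕ) :
    ∃ C, 0 ≤ C ∧ ∀ (j : ℕ) (x : ℝ), e ≤ j → 0 ≤ x →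
      ‖iteratedDeriv j planckReg x‖ ≤ C * j.factorial / r ^ j / (1 + x) ^ (e + 1) := by
  obtain ⟨C1, hC1, h1⟩ := exists_bound_planckReg hr' (r + 1)
  obtain ⟨C2, hC2, h2⟩ := norm_iteratedDeriv_planck_le hr e
  refine ⟨C1 * (2 + r) ^ (e + 1) + (C2 + r ^ e * 2 ^ (e + 1)), by positivity,
    fun j x hj hx => ?_⟩
  -- For bounded `x` the circles stay in a compact set on which `planckReg` is bounded. For large
  -- `x` the parts `1/(e^z - 1)` and `1/z` are estimated separately.
  rcases le_total x (r + 1) with hxr | hxr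
  · have hd : DiffContOnCl ℂ planckReg (Metric.ball (x : ℂ) r) :=
      ((differentiableOn_planckReg_ball x).mono
        (Metric.closedBall_subset_ball hr')).diffContOnCl_ball Subset.rfl
    refine (Complex.norm_iteratedDeriv_le_of_forall_mem_sphere_norm_le (C := C1) j hr hd
      fun z hz => h1 x ⟨hx, hxr⟩ z ?_).trans ?_
    · rw [mem_sphere_iff_norm] at hz
      exact hz.le
    · have : C1 ≤ C1 * (2 + r) ^ (e + 1) / (1 + x) ^ (e + 1) := by
        rw [mul_div_assoc]
        refine le_mul_of_one_le_right hC1 ?_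
        rw [one_le_div (by positivity)]
        gcongr ?_ ^ _
        linarith
      calc j.factorial * C1 / r ^ j
          ≤ j.factorial * (C1 * (2 + r) ^ (e + 1) / (1 + x) ^ (e + 1)) / r ^ j := by gcongr
        _ = (C1 * (2 + r) ^ (e + 1)) * j.factorial / r ^ j / (1 + x) ^ (e + 1) := by ring
        _ ≤ _ := by
          gcongr
          have : 0 ≤ C2 + r ^ e * 2 ^ (e + 1) := by positivity
          linarith
  · have hx0 : 0 < x := by linarith
    rw [iteratedDeriv_planckReg_eq j hx0]
    refine (norm_sub_le _ _).trans ?_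
    have h3 : ‖(-1) ^ j * (j.factorial : ℂ) * (x : ℂ) ^ (-1 - (j : ℤ))‖ ≤
        (r ^ e * 2 ^ (e + 1)) * j.factorial / r ^ j / (1 + x) ^ (e + 1) := by
      rw [norm_mul, norm_mul, norm_pow, norm_neg, norm_one, one_pow, one_mul,
        Complex.norm_natCast, norm_zpow, Complex.norm_real, Real.norm_of_nonneg hx]
      -- Of the `j + 1` powers of `1/x`, `e + 1` supply the decay and the remaining `j - e` are
      -- bounded by powers of `1/r`. This is where `e ≤ j` enters.
      have h4 : x ^ (-1 - (j : ℤ)) = 1 / (x ^ (e + 1) * x ^ (j - e)) := by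
        rw [← pow_add, show e + 1 + (j - e) = j + 1 by omega, show -1 - (j : ℤ) = -((j + 1 : ℕ) : ℤ) by
          push_cast; ring, zpow_neg, zpow_natCast, one_div]
      have h5 : ((1 + x) / 2) ^ (e + 1) * r ^ (j - e) ≤ x ^ (e + 1) * x ^ (j - e) := by
        gcongr <;> linarith
      calc j.factorial * x ^ (-1 - (j : ℤ))
          ≤ j.factorial * (1 / (((1 + x) / 2) ^ (e + 1) * r ^ (j - e))) := by
            rw [h4]
            gcongr
        _ = _ := by
            rw [div_pow, show r ^ j = r ^ (j - e) * r ^ e by rw [← pow_add]; congr 1; omega]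
            field_simp
    calc _ ≤ C2 * j.factorial / r ^ j / (1 + x) ^ (e + 1) +
          (r ^ e * 2 ^ (e + 1)) * j.factorial / r ^ j / (1 + x) ^ (e + 1) :=
          add_le_add (h2 j x hxr) h3
      _ = (C2 + r ^ e * 2 ^ (e + 1)) * j.factorial / r ^ j / (1 + x) ^ (e + 1) := by ring
      _ ≤ _ := by
        gcongr ?_ * _ / _ / _
        have : 0 ≤ C1 * (2 + r) ^ (e + 1) := by positivity
        linarith

/-! ### Mellin transforms and the zeta values. -/

lemma summable_succ_pow_mul_exp (j : ℕ) {δ : ℝ} (hδ : 0 < δ) :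
    Summable fun n : ℕ => ((n : ℝ) + 1) ^ j * Real.exp (-δ * ((n : ℝ) + 1)) := by
  have := (summable_nat_add_iff 1).2 (Real.summable_pow_mul_exp_neg_nat_mul j hδ)
  simpa using this

lemma norm_neg_succ_pow_mul_exp_le (j n : ℕ) {δ : ℝ} {z : ℂ} (hz : δ ≤ z.re) :
    ‖(-((n : ℂ) + 1)) ^ j * Complex.exp (-((n : ℂ) + 1) * z)‖ ≤
      ((n : ℝ) + 1) ^ j * Real.exp (-δ * ((n : ℝ) + 1)) := by
  have h : ‖(n : ℂ) + 1‖ = (n : ℝ) + 1 := by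
    rw [← Nat.cast_succ, Complex.norm_natCast, Nat.cast_succ]
  have h2 : (-((n : ℂ) + 1) * z).re = -((n : ℝ) + 1) * z.re := by simp
  rw [norm_mul, norm_pow, norm_neg, h, Complex.norm_exp, h2]
  refine mul_le_mul_of_nonneg_left (Real.exp_le_exp.2 ?_) (by positivity)
  nlinarith [n.cast_nonneg (α := ℝ)]

lemma hasSum_iteratedDeriv_planck (j : ℕ) : ∀ {z : ℂ}, 0 < z.re →
    HasSum (fun n : ℕ => (-((n : ℂ) + 1)) ^ j * Complex.exp (-((n : ℂ) + 1) * z))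
      (iteratedDeriv j planck z) := by
  induction j with
  | zero =>
    intro z hz
    have hq : ‖Complex.exp (-z)‖ < 1 := by
      rw [Complex.norm_exp, Complex.neg_re, Real.exp_lt_one_iff]
      linarith
    have h := (hasSum_geometric_of_norm_lt_one hq).mul_right (Complex.exp (-z))
    have hne : Complex.exp z - 1 ≠ 0 := by
      intro h0
      rw [Complex.exp_neg, sub_eq_zero.1 h0] at hq
      simp at hq
    have e : (1 - Complex.exp (-z))⁻¹ * Complex.exp (-z) = iteratedDeriv 0 planck z := by
      have := Complex.exp_ne_zero z
      rw [iteratedDeriv_zero, planck, Complex.exp_neg]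
      have h1 : 1 - (Complex.exp z)⁻¹ ≠ 0 := by
        rw [show 1 - (Complex.exp z)⁻¹ = (Complex.exp z - 1) / Complex.exp z by field_simp]
        exact div_ne_zero hne this
      field_simp
    rw [e] at h
    refine h.congr_fun fun n => ?_
    rw [pow_zero, one_mul, ← Complex.exp_nat_mul, ← Complex.exp_add]
    congr 1
    ring
  | succ j ih =>
    intro z hz
    have hd : ∀ n : ℕ, ∀ w : ℂ, HasDerivAt
        (fun w => (-((n : ℂ) + 1)) ^ j * Complex.exp (-((n : ℂ) + 1) * w))
        ((-((n : ℂ) + 1)) ^ (j + 1) * Complex.exp (-((n : ℂ) + 1) * w)) w := fun n w => by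
      have h1 : HasDerivAt (fun w : ℂ => -((n : ℂ) + 1) * w) (-((n : ℂ) + 1)) w := by
        simpa using (hasDerivAt_id w).const_mul (-((n : ℂ) + 1))
      refine (h1.cexp.const_mul _).congr_deriv ?_
      rw [pow_succ]
      ring
    have h := Complex.hasSum_deriv_of_summable_norm (U := {w : ℂ | z.re / 2 < w.re}) (z := z)
      (F := fun (n : ℕ) w => (-((n : ℂ) + 1)) ^ j * Complex.exp (-((n : ℂ) + 1) * w))
      (summable_succ_pow_mul_exp j (half_pos hz))
      (fun n w _ => (hd n w).differentiableAt.differentiableWithinAt)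
      (isOpen_lt continuous_const Complex.continuous_re)
      (fun n w hw => norm_neg_succ_pow_mul_exp_le j n (le_of_lt hw))
      (show z.re / 2 < z.re by linarith)
    have he : (fun w => ∑' n : ℕ, (-((n : ℂ) + 1)) ^ j * Complex.exp (-((n : ℂ) + 1) * w)) =ᶠ[𝓝 z]
        iteratedDeriv j planck := by
      filter_upwards [(isOpen_lt continuous_const Complex.continuous_re).mem_nhds hz] with w hw
      exact (ih hw).tsum_eq
    rw [he.deriv_eq, ← iteratedDeriv_succ] at h
    exact h.congr_fun fun n => ((hd n z).deriv).symm

/-- Termwise Mellin transform of the exponential series: `n^k · n^{-s}` sums to `ζ(s - k)` in the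
half-plane of absolute convergence. -/
lemma mellin_iteratedDeriv_planck (k : ℕ) {s : ℂ} (hs : (k : ℝ) + 1 < s.re) :
    mellin (fun x : ℝ => iteratedDeriv k planck x) s =
      (-1) ^ k * Complex.Gamma s * riemannZeta (s - k) := by
  have hs0 : 0 < s.re := lt_trans (by positivity) hs
  have hnorm : ∀ n : ℕ, ‖(-((n : ℂ) + 1)) ^ k‖ = ((n : ℝ) + 1) ^ k := fun n => by
    rw [norm_pow, norm_neg, ← Nat.cast_succ, Complex.norm_natCast, Nat.cast_succ]
  have h := hasSum_mellin (ι := ℕ) (a := fun n => (-((n : ℂ) + 1)) ^ k) (p := fun n => (n : ℝ) + 1)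
    (F := fun x : ℝ => iteratedDeriv k planck x) (s := s)
    (fun n => Or.inr (by positivity)) hs0 (fun t ht => by
      refine (hasSum_iteratedDeriv_planck k (z := t) (by simpa using ht)).congr_fun fun n => ?_
      push_cast
      rfl) (by
      have : Summable fun n : ℕ => 1 / ((n : ℝ) + 1) ^ (s.re - k) := by
        have := (summable_nat_add_iff 1).2 (Real.summable_one_div_nat_rpow.2
          (show 1 < s.re - k by linarith))
        simpa using this
      refine this.congr fun n => ?_
      have hn : (0 : ℝ) < (n : ℝ) + 1 := by positivity
      rw [hnorm, Real.rpow_sub hn, Real.rpow_natCast]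
      field_simp)
  rw [← h.tsum_eq, zeta_eq_tsum_one_div_nat_add_one_cpow (by simp; linarith), ← tsum_mul_left]
  refine tsum_congr fun n => ?_
  have hn : ((n : ℂ) + 1) ≠ 0 := by exact_mod_cast n.succ_ne_zero
  have hp : ((n : ℂ) + 1) ^ s ≠ 0 := by simp [Complex.cpow_eq_zero_iff, hn]
  rw [Complex.cpow_sub _ _ hn, Complex.cpow_natCast, neg_pow]
  push_cast
  field_simp

lemma continuous_iteratedDeriv_planckReg (k : ℕ) :
    Continuous fun x : ℝ => iteratedDeriv k planckReg x :=
  continuous_iff_continuousAt.2 fun x => (hasDerivAt_iteratedDeriv_planckReg k x).continuousAt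

/-- `(1/x)^(k)` truncated to `(0, 1]`. -/
noncomputable def truncInv (k : ℕ) (x : ℝ) : ℂ :=
  ((-1) ^ k * (k.factorial : ℂ)) •
    (Ioc (0 : ℝ) 1).indicator (fun t : ℝ => (t : ℂ) ^ (((-1 - (k : ℤ) : ℤ)) : ℂ)) x

lemma hasMellin_truncInv (k : ℕ) {s : ℂ} (hs : (k : ℝ) + 1 < s.re) :
    MellinConvergent (truncInv k) s ∧
      mellin (truncInv k) s = (-1) ^ k * (k.factorial : ℂ) / (s - k - 1) := by
  have h := hasMellin_cpow_Ioc (((-1 - (k : ℤ) : ℤ)) : ℂ) (s := s) (by simp; linarith)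
  refine ⟨h.1.const_smul _, ?_⟩
  have h2 := mellin_const_smul ((Ioc (0 : ℝ) 1).indicator
    (fun t : ℝ => (t : ℂ) ^ (((-1 - (k : ℤ) : ℤ)) : ℂ))) s ((-1) ^ k * (k.factorial : ℂ))
  rw [h.2] at h2
  refine Eq.trans h2 ?_
  rw [smul_eq_mul, mul_one_div]
  congr 1
  push_cast
  ring

/-- `planck^(k)` with its singular part at `0` removed on `(0, 1]`. -/
noncomputable def planckCut (k : ℕ) (x : ℝ) : ℂ := iteratedDeriv k planck x - truncInv k x

lemma planckCut_of_le (k : ℕ) {x : ℝ} (hx : 0 < x) (hx1 : x ≤ 1) :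
    planckCut k x = iteratedDeriv k planckReg x := by
  rw [planckCut, truncInv, indicator_of_mem (show x ∈ Ioc 0 1 from ⟨hx, hx1⟩),
    iteratedDeriv_planckReg_eq k hx, Complex.cpow_intCast, smul_eq_mul]

lemma planckCut_of_lt (k : ℕ) {x : ℝ} (hx1 : 1 < x) :
    planckCut k x = iteratedDeriv k planck x := by
  rw [planckCut, truncInv, indicator_of_notMem (fun h => hx1.not_ge h.2), smul_zero, sub_zero]

lemma continuousOn_iteratedDeriv_planck (k : ℕ) :
    ContinuousOn (fun x : ℝ => iteratedDeriv k planck x) (Ioi 0) := by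
  intro x hx
  have hx' : (0 : ℝ) < x := hx
  have a1 : AnalyticAt ℂ planck x :=
    (analyticAt_cexp.sub analyticAt_const).fun_inv (sub_ne_zero.2 (exp_ne_one_of_pos hx'))
  have a2 := (a1.iterated_deriv k).continuousAt
  rw [← iteratedDeriv_eq_iterate] at a2
  exact (a2.comp (f := fun x : ℝ => (x : ℂ))
    Complex.continuous_ofReal.continuousAt).continuousWithinAt

lemma locallyIntegrableOn_planckCut (k : ℕ) : LocallyIntegrableOn (planckCut k) (Ioi 0) := by
  have h1 := (continuousOn_iteratedDeriv_planck k).locallyIntegrableOn (μ := volume)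
    measurableSet_Ioi
  refine h1.sub ?_
  have h2 : LocallyIntegrableOn (fun t : ℝ => (t : ℂ) ^ (((-1 - (k : ℤ) : ℤ)) : ℂ)) (Ioi 0) := by
    refine ContinuousOn.locallyIntegrableOn (fun t ht => ?_) measurableSet_Ioi
    exact (Complex.continuousAt_ofReal_cpow_const _ _
      (Or.inr (ne_of_gt ht))).continuousWithinAt
  have hlc : IsLocallyClosed (Ioi (0 : ℝ)) := isOpen_Ioi.isLocallyClosed
  rw [locallyIntegrableOn_iff hlc] at h2 ⊢
  exact fun K hK hKc => ((h2 K hK hKc).indicator measurableSet_Ioc).smul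
    ((-1) ^ k * (k.factorial : ℂ))

lemma planckCut_isBigO_atTop (k e : ℕ) :
    planckCut k =O[atTop] fun x : ℝ => x ^ (-((e : ℝ) + 1)) := by
  obtain ⟨C, hC, h⟩ := norm_iteratedDeriv_planck_le one_pos e
  refine IsBigO.of_bound (C * k.factorial / 1 ^ k) ?_
  filter_upwards [eventually_ge_atTop 2] with x hx
  have hx0 : 0 < x := by linarith
  rw [planckCut_of_lt k (by linarith), Real.norm_of_nonneg (by positivity), Real.rpow_neg hx0.le,
    ← Nat.cast_succ, Real.rpow_natCast, ← div_eq_mul_inv]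
  refine (h k x (by linarith)).trans ?_
  gcongr
  linarith

lemma exists_norm_iteratedDeriv_planckReg_le (e k : ℕ) (hek : e ≤ k) :
    ∃ C, 0 ≤ C ∧ ∀ x : ℝ, 0 ≤ x → ‖iteratedDeriv k planckReg x‖ ≤ C / (1 + x) ^ (e + 1) := by
  obtain ⟨C, hC, h⟩ := norm_iteratedDeriv_planckReg_le one_pos
    (by linarith [Real.pi_gt_three]) e
  exact ⟨C * k.factorial / 1 ^ k, by positivity, fun x hx => h k x hek hx⟩

lemma planckReg_isBigO_zero (k : ℕ) :
    (fun x : ℝ => iteratedDeriv k planckReg x) =O[𝓝[>] 0] fun x : ℝ => x ^ (-(0 : ℝ)) := by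
  obtain ⟨C, hC, h⟩ := exists_norm_iteratedDeriv_planckReg_le 0 k (Nat.zero_le k)
  refine IsBigO.of_bound C (eventually_nhdsWithin_of_forall fun x hx => ?_)
  have hx0 : (0 : ℝ) < x := hx
  rw [neg_zero, Real.rpow_zero, norm_one, mul_one]
  exact (h x hx0.le).trans (div_le_self hC (one_le_pow₀ (by linarith)))

lemma planckCut_isBigO_zero (k : ℕ) :
    planckCut k =O[𝓝[>] 0] fun x : ℝ => x ^ (-(0 : ℝ)) := by
  refine (planckReg_isBigO_zero k).congr' ?_ EventuallyEq.rfl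
  filter_upwards [Ioo_mem_nhdsGT one_pos] with x hx
  exact (planckCut_of_le k hx.1 hx.2.le).symm

lemma lt_ceil_add_one (y : ℝ) : y < (⌈y⌉₊ : ℝ) + 1 := (Nat.le_ceil y).trans_lt (lt_add_one _)

lemma mellinConvergent_planckCut (k : ℕ) {s : ℂ} (hs : 0 < s.re) :
    MellinConvergent (planckCut k) s :=
  mellinConvergent_of_isBigO_rpow (locallyIntegrableOn_planckCut k)
    (planckCut_isBigO_atTop k ⌈s.re⌉₊) (lt_ceil_add_one _) (planckCut_isBigO_zero k) hs

lemma differentiableAt_mellin_planckCut (k : ℕ) {s : ℂ} (hs : 0 < s.re) :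
    DifferentiableAt ℂ (mellin (planckCut k)) s :=
  mellin_differentiableAt_of_isBigO_rpow (locallyIntegrableOn_planckCut k)
    (planckCut_isBigO_atTop k ⌈s.re⌉₊) (lt_ceil_add_one _) (planckCut_isBigO_zero k) hs

lemma mellin_planckCut_of_lt (k : ℕ) {s : ℂ} (hs : (k : ℝ) + 1 < s.re) :
    mellin (planckCut k) s = (-1) ^ k * Complex.Gamma s * riemannZeta (s - k) -
      (-1) ^ k * (k.factorial : ℂ) / (s - k - 1) := by
  have hs0 : 0 < s.re := lt_trans (by positivity) hs
  have h := (hasMellin_add (mellinConvergent_planckCut k hs0) (hasMellin_truncInv k hs).1).2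
  rw [(hasMellin_truncInv k hs).2] at h
  have e : (fun t => planckCut k t + truncInv k t) = fun x : ℝ => iteratedDeriv k planck x := by
    funext t
    simp [planckCut]
  rw [e, mellin_iteratedDeriv_planck k hs] at h
  exact eq_sub_of_add_eq h.symm

/-- Analytic continuation from `Re s > k + 1`. The domain, cut out by `Re s > 0` and `Re s - Im s <
k + 1`, is convex and has the pole `s = k + 1` on its boundary, so the identity theorem applies
without discussing the removable singularity. -/
lemma mellin_planckCut (k : ℕ) {s : ℂ} (hs : 0 < s.re) (hs' : s.re - (k + 1) < s.im) :
    mellin (planckCut k) s = (-1) ^ k * Complex.Gamma s * riemannZeta (s - k) -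
      (-1) ^ k * (k.factorial : ℂ) / (s - k - 1) := by
  set V : Set ℂ := {s : ℂ | 0 < s.re} ∩ {s : ℂ | s.re - s.im < k + 1} with hV
  have hVo : IsOpen V := (isOpen_lt continuous_const Complex.continuous_re).inter
    (isOpen_lt (Complex.continuous_re.sub Complex.continuous_im) continuous_const)
  have hVc : Convex ℝ V := by
    refine (convex_halfSpace_re_gt 0).inter ?_
    exact convex_halfSpace_lt (f := fun s : ℂ => s.re - s.im)
      ⟨fun x y => by simp; ring, fun c x => by simp; ring⟩ _
  have hne : ∀ s ∈ V, s - k - 1 ≠ 0 := fun s hs h => by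
    have h1 := congrArg Complex.re h
    have h2 := congrArg Complex.im h
    simp at h1 h2
    have : s.re - s.im < k + 1 := hs.2
    linarith
  have a1 : AnalyticOnNhd ℂ (mellin (planckCut k)) V := DifferentiableOn.analyticOnNhd
    (fun s hs => (differentiableAt_mellin_planckCut k hs.1).differentiableWithinAt) hVo
  have a2 : AnalyticOnNhd ℂ (fun s : ℂ => (-1) ^ k * Complex.Gamma s * riemannZeta (s - k) -
      (-1) ^ k * (k.factorial : ℂ) / (s - k - 1)) V := by
    refine DifferentiableOn.analyticOnNhd (fun s hs => ?_) hVo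
    refine DifferentiableAt.differentiableWithinAt ?_
    have hG : DifferentiableAt ℂ Complex.Gamma s := Complex.differentiableAt_Gamma _ fun m hm => by
      have : 0 < s.re := hs.1
      rw [hm] at this
      simp at this
      linarith [m.cast_nonneg (α := ℝ)]
    have hz : DifferentiableAt ℂ (fun s : ℂ => riemannZeta (s - k)) s := by
      refine (differentiableAt_riemannZeta ?_).comp s (differentiableAt_id.sub_const (k : ℂ))
      exact fun h => hne s hs (sub_eq_zero.2 h)
    exact ((hG.const_mul _).mul hz).sub ((differentiableAt_const _).fun_div
      ((differentiableAt_id.sub_const _).sub_const _) (hne s hs))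
  -- The base point `k + 2 + 2i` lies both in the convex domain and in the half-plane where the
  -- formula is known.
  refine a1.eqOn_of_preconnected_of_eventuallyEq a2 hVc.isPreconnected
    (z₀ := (k + 2 : ℝ) + (2 : ℝ) * Complex.I) ⟨?_, ?_⟩ ?_ ⟨hs, ?_⟩
  · simp
    positivity
  · simp
  · filter_upwards [(isOpen_lt continuous_const Complex.continuous_re).mem_nhds
      (show (k : ℝ) + 1 < ((k + 2 : ℝ) + (2 : ℝ) * Complex.I : ℂ).re by simp)] with w hw
    exact mellin_planckCut_of_lt k hw
  · show s.re - s.im < k + 1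
    linarith

lemma hasMellin_Ioi_cpow {a s : ℂ} (h : (s + a).re < 0) :
    HasMellin ((Ioi (1 : ℝ)).indicator fun t : ℝ => (t : ℂ) ^ a) s (-1 / (s + a)) := by
  have e : EqOn ((Ioi (1 : ℝ)).indicator fun t : ℝ => (t : ℂ) ^ (s + a - 1))
      (fun t : ℝ => (t : ℂ) ^ (s - 1) • (Ioi (1 : ℝ)).indicator (fun t : ℝ => (t : ℂ) ^ a) t)
      (Ioi 0) := fun t ht => by
    have ht0 : (t : ℂ) ≠ 0 := by exact_mod_cast (ne_of_gt ht)
    by_cases h1 : t ∈ Ioi (1 : ℝ)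
    · simp only [indicator_of_mem h1, smul_eq_mul]
      rw [← Complex.cpow_add _ _ ht0]
      congr 1
      ring
    · simp only [indicator_of_notMem h1, smul_zero]
  have hr : (s + a - 1).re < -1 := by
    rw [Complex.sub_re, Complex.one_re]
    linarith
  have hsub : Ioi (1 : ℝ) ⊆ Ioi 0 := Ioi_subset_Ioi zero_le_one
  refine ⟨?_, ?_⟩
  · refine IntegrableOn.congr_fun ?_ e measurableSet_Ioi
    exact ((integrableOn_Ioi_cpow_of_lt hr one_pos).integrable_indicator
      measurableSet_Ioi).integrableOn
  · rw [mellin, ← setIntegral_congr_fun measurableSet_Ioi e,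
      setIntegral_indicator measurableSet_Ioi, inter_eq_self_of_subset_right hsub,
      integral_Ioi_cpow_of_lt hr one_pos]
    simp

/-- The Mellin transform of `(1/(e^x - 1) - 1/x)^(k)`. -/
lemma mellin_iteratedDeriv_planckReg (k : ℕ) {s : ℂ} (hs : 0 < s.re) (hs1 : s.re < k + 1)
    (hs' : s.re - (k + 1) < s.im) :
    mellin (fun x : ℝ => iteratedDeriv k planckReg x) s =
      (-1) ^ k * Complex.Gamma s * riemannZeta (s - k) := by
  -- For `Re s < k + 1` the singular part is Mellin integrable on `(1, ∞)`. Removing it there as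
  -- well contributes exactly the opposite of the pole term in `mellin_planckCut`.
  have h := hasMellin_Ioi_cpow (a := (((-1 - (k : ℤ) : ℤ)) : ℂ)) (s := s) (by simp; linarith)
  have h2 := (hasMellin_sub (mellinConvergent_planckCut k hs)
    (h.1.const_smul ((-1) ^ k * (k.factorial : ℂ)))).2
  rw [mellin_const_smul, h.2, mellin_planckCut k hs hs'] at h2
  have e : mellin (fun x : ℝ => iteratedDeriv k planckReg x) s = mellin (fun t => planckCut k t -
      ((-1) ^ k * (k.factorial : ℂ)) • (Ioi (1 : ℝ)).indicator
        (fun t : ℝ => (t : ℂ) ^ (((-1 - (k : ℤ) : ℤ)) : ℂ)) t) s := by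
    refine setIntegral_congr_fun measurableSet_Ioi fun x hx => ?_
    have hx0 : (0 : ℝ) < x := hx
    simp only
    congr 1
    rcases le_or_gt x 1 with h1 | h1
    · rw [planckCut_of_le k hx0 h1, indicator_of_notMem (show x ∉ Ioi (1 : ℝ) from fun h => h1.not_gt h),
        smul_zero, sub_zero]
    · rw [planckCut_of_lt k h1, indicator_of_mem (show x ∈ Ioi 1 from h1),
        iteratedDeriv_planckReg_eq k hx0, Complex.cpow_intCast, smul_eq_mul]
  rw [e, h2, smul_eq_mul]
  have e3 : s + (((-1 - (k : ℤ) : ℤ)) : ℂ) = s - k - 1 := by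
    push_cast
    ring
  rw [e3]
  ring

lemma tendsto_iteratedDeriv_planckReg_atTop (k : ℕ) :
    Tendsto (fun x : ℝ => iteratedDeriv k planckReg x) atTop (𝓝 0) := by
  obtain ⟨C, hC, h⟩ := exists_norm_iteratedDeriv_planckReg_le 0 k (Nat.zero_le k)
  refine squeeze_zero_norm' (eventually_atTop.2 ⟨1, fun x hx => (h x (by linarith)).trans
    (?_ : _ ≤ C * x⁻¹)⟩) (by simpa using tendsto_inv_atTop_zero.const_mul C)
  rw [div_eq_mul_inv, zero_add, pow_one]
  gcongr
  linarith

lemma integrableOn_iteratedDeriv_planckReg_succ (j : ℕ) :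
    IntegrableOn (fun x : ℝ => iteratedDeriv (j + 1) planckReg x) (Ioi 0) := by
  obtain ⟨C, hC, h⟩ := exists_norm_iteratedDeriv_planckReg_le 1 (j + 1) (by omega)
  have h1 : IntegrableOn (fun x : ℝ => C / (1 + x) ^ 2) (Ioi 0) := by
    have h2 : IntegrableOn (fun x : ℝ => (x + 1) ^ (-2 : ℝ)) (Ioi 0) :=
      integrableOn_add_rpow_Ioi_of_lt (by norm_num) (by norm_num)
    refine IntegrableOn.congr_fun (h2.const_mul C) (fun x hx => ?_) measurableSet_Ioi
    have hx0 : (0 : ℝ) < x := hx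
    show C * (x + 1) ^ (-2 : ℝ) = C / (1 + x) ^ 2
    rw [Real.rpow_neg (by linarith), Real.rpow_two, add_comm x, div_eq_mul_inv]
  exact Integrable.mono' h1 (continuous_iteratedDeriv_planckReg _).aestronglyMeasurable
    ((ae_restrict_iff' measurableSet_Ioi).2 (ae_of_all _ fun x hx => h x (le_of_lt hx)))

/-- One derivative at least is taken, so that `s = 1` is interior to both the strip `0 < Re s < j +
2` and the convex domain. The identity can then be differentiated at `1`. -/
lemma eventually_mellin_iteratedDeriv_planckReg (j : ℕ) :
    mellin (fun x : ℝ => iteratedDeriv (j + 1) planckReg x) =ᶠ[𝓝 1] fun s =>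
      (-1) ^ (j + 1) * Complex.Gamma s * riemannZeta (s - (j + 1 : ℕ)) := by
  have o1 : ∀ᶠ s : ℂ in 𝓝 1, 0 < s.re :=
    (isOpen_lt continuous_const Complex.continuous_re).mem_nhds (by simp)
  have o2 : ∀ᶠ s : ℂ in 𝓝 1, s.re < (j + 1 : ℕ) + 1 :=
    (isOpen_lt Complex.continuous_re continuous_const).mem_nhds (by
      simp
      positivity)
  have o3 : ∀ᶠ s : ℂ in 𝓝 1, s.re - ((j + 1 : ℕ) + 1) < s.im :=
    (isOpen_lt (Complex.continuous_re.sub continuous_const) Complex.continuous_im).mem_nhds (by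
      simp
      linarith [j.cast_nonneg (α := ℝ)])
  filter_upwards [o1, o2, o3] with s h1 h2 h3
  exact mellin_iteratedDeriv_planckReg (j + 1) h1 h2 h3

/-- At `s = 1` the Mellin transform is the plain integral of `g^(j+1)`, which equals `-g^(j)(0)`. -/
lemma iteratedDeriv_planckReg_zero (j : ℕ) :
    iteratedDeriv j planckReg 0 = (-1) ^ j * riemannZeta (-j) := by
  have h1 := (eventually_mellin_iteratedDeriv_planckReg j).eq_of_nhds
  have h2 := integral_Ioi_of_hasDerivAt_of_tendsto (a := (0 : ℝ))
    (continuous_iteratedDeriv_planckReg j).continuousWithinAt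
    (fun x _ => hasDerivAt_iteratedDeriv_planckReg j x)
    (integrableOn_iteratedDeriv_planckReg_succ j) (tendsto_iteratedDeriv_planckReg_atTop j)
  have e : mellin (fun x : ℝ => iteratedDeriv (j + 1) planckReg x) 1 =
      ∫ x in Ioi (0 : ℝ), iteratedDeriv (j + 1) planckReg x := by simp [mellin]
  rw [e, h2, Complex.Gamma_one, show (1 : ℂ) - (j + 1 : ℕ) = -j by push_cast; ring] at h1
  rw [Complex.ofReal_zero] at h1
  rw [pow_succ] at h1
  linear_combination -h1

/-- Differentiating the Mellin identity at `s = 1` inserts `log x` on the left. On the right, `Γ'(1)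
= -γ` gives the Euler constant. -/
lemma neg_integral_iteratedDeriv_planckReg_mul_log (j : ℕ) :
    -∫ x in Ioi (0 : ℝ), iteratedDeriv (j + 1) planckReg x * (Real.log x : ℂ) =
      (-1) ^ j * (deriv riemannZeta (-j) - Real.eulerMascheroniConstant * riemannZeta (-j)) := by
  obtain ⟨C, hC, h⟩ := exists_norm_iteratedDeriv_planckReg_le 1 (j + 1) (by omega)
  have hO : (fun x : ℝ => iteratedDeriv (j + 1) planckReg x) =O[atTop]
      fun x : ℝ => x ^ (-(2 : ℝ)) := by
    refine IsBigO.of_bound C ?_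
    filter_upwards [eventually_gt_atTop 0] with x hx
    rw [Real.norm_of_nonneg (by positivity), Real.rpow_neg hx.le, Real.rpow_two, ← div_eq_mul_inv]
    refine (h x hx.le).trans ?_
    gcongr
    linarith
  have h1 := (mellin_hasDerivAt_of_isBigO_rpow (s := 1)
    ((continuous_iteratedDeriv_planckReg (j + 1)).locallyIntegrable.locallyIntegrableOn _) hO
    (by simp) (planckReg_isBigO_zero (j + 1)) (by simp)).2
  have hz : HasDerivAt (fun s : ℂ => riemannZeta (s - (j + 1 : ℕ))) (deriv riemannZeta (-j)) 1 := by
    have e : (1 : ℂ) - (j + 1 : ℕ) = -j := by push_cast; ring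
    have h0 : DifferentiableAt ℂ riemannZeta (1 - (j + 1 : ℕ)) := by
      refine differentiableAt_riemannZeta fun h => ?_
      rw [e] at h
      have := congrArg Complex.re h
      simp at this
      linarith [j.cast_nonneg (α := ℝ)]
    have := h0.hasDerivAt.comp (1 : ℂ) ((hasDerivAt_id (1 : ℂ)).sub_const ((j + 1 : ℕ) : ℂ))
    rw [e, mul_one] at this
    exact this
  have h2 := ((Complex.hasDerivAt_Gamma_one.const_mul ((-1) ^ (j + 1))).mul hz).congr_of_eventuallyEq
    (eventually_mellin_iteratedDeriv_planckReg j)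
  have h3 := h1.unique h2
  have e : mellin (fun t : ℝ => Real.log t • iteratedDeriv (j + 1) planckReg t) 1 =
      ∫ x in Ioi (0 : ℝ), iteratedDeriv (j + 1) planckReg x * (Real.log x : ℂ) := by
    simp [mellin, mul_comm]
  rw [e, Complex.Gamma_one, show (1 : ℂ) - (j + 1 : ℕ) = -j by push_cast; ring] at h3
  rw [h3, pow_succ]
  ring

/-! ### The closed-form integral of `1/(a + b cosh t)`. -/

lemma hasDerivAt_tanh_half (t : ℝ) :
    HasDerivAt (fun t => Real.tanh (t / 2)) (1 / (2 * Real.cosh (t / 2) ^ 2)) t := by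
  have hc := (Real.cosh_pos (t / 2)).ne'
  have h1 : HasDerivAt (fun t : ℝ => t / 2) (1 / 2) t := (hasDerivAt_id t).div_const 2
  have h := h1.sinh.fun_div h1.cosh hc
  simp only [← Real.tanh_eq_sinh_div_cosh] at h
  refine h.congr_deriv ?_
  have := Real.cosh_sq (t / 2)
  field_simp
  linarith

lemma tendsto_tanh_half : Tendsto (fun t : ℝ => Real.tanh (t / 2)) atTop (𝓝 1) := by
  have h1 : Tendsto (fun t : ℝ => Real.exp (-t)) atTop (𝓝 0) := Real.tendsto_exp_neg_atTop_nhds_zero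
  have h2 : Tendsto (fun t : ℝ => (1 - Real.exp (-t)) / (1 + Real.exp (-t))) atTop
      (𝓝 ((1 - 0) / (1 + 0))) := (h1.const_sub 1).div (h1.const_add 1) (by norm_num)
  norm_num at h2
  refine h2.congr fun t => ?_
  have e : Real.exp (-t) = Real.exp (-(t / 2)) * Real.exp (-(t / 2)) := by
    rw [← Real.exp_add]
    congr 1
    ring
  have e2 : Real.exp (t / 2) * Real.exp (-(t / 2)) = 1 := by
    rw [← Real.exp_add]
    simp
  have p := Real.exp_pos (-(t / 2))
  have p2 := Real.exp_pos (t / 2)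
  rw [Real.tanh_eq_sinh_div_cosh, Real.sinh_eq, Real.cosh_eq, e,
    div_eq_div_iff (by positivity) (by positivity)]
  linear_combination (-Real.exp (-(t / 2))) * e2

lemma cosh_half_sq (t : ℝ) : Real.cosh (t / 2) ^ 2 = (Real.cosh t + 1) / 2 := by
  have h1 := Real.cosh_two_mul (t / 2)
  rw [show 2 * (t / 2) = t by ring] at h1
  have h2 := Real.cosh_sq (t / 2)
  linarith

lemma inv_add_mul_cosh_le {a b : ℝ} (ha : 0 ≤ a) (hb : 0 < b) (t : ℝ) :
    (a + b * Real.cosh t)⁻¹ ≤ 2 / b * Real.exp (-1 * t) := by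
  have hc := Real.cosh_pos t
  calc (a + b * Real.cosh t)⁻¹ ≤ (b * Real.cosh t)⁻¹ := by
        gcongr
        linarith
    _ = b⁻¹ * (Real.cosh t)⁻¹ := by rw [mul_inv]
    _ ≤ b⁻¹ * (2 * Real.exp (-1 * t)) := by
        gcongr
        exact inv_cosh_le_two_mul_exp_neg t
    _ = _ := by ring

lemma integrableOn_inv_add_mul_cosh {a b : ℝ} (ha : 0 ≤ a) (hb : 0 < b) :
    IntegrableOn (fun t => (a + b * Real.cosh t)⁻¹) (Ioi 0) := by
  have hp : ∀ t, 0 < a + b * Real.cosh t := fun t => by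
    have := Real.cosh_pos t
    positivity
  refine Integrable.mono' ((exp_neg_integrableOn_Ioi 0 one_pos).const_mul (2 / b))
    (Continuous.inv₀ (by fun_prop) fun t => (hp t).ne').aestronglyMeasurable
    (ae_of_all _ fun t => ?_)
  rw [Real.norm_of_nonneg (inv_nonneg.2 (hp t).le)]
  exact inv_add_mul_cosh_le ha hb t

lemma two_mul_arctan_sqrt {a b : ℝ} (ha : 0 < a) (hab : a < b) :
    2 * Real.arctan (√((b - a) / (b + a))) = Real.pi / 2 - Real.arcsin (a / b) := by
  have hk : 0 ≤ (b - a) / (b + a) := div_nonneg (by linarith) (by linarith)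
  set x := Real.arctan (√((b - a) / (b + a))) with hx
  have h0 : 0 ≤ x := Real.arctan_nonneg.2 (Real.sqrt_nonneg _)
  have h1 : x < Real.pi / 2 := Real.arctan_lt_pi_div_two _
  have hc : Real.cos (2 * x) = a / b := by
    have : b ≠ 0 := by linarith
    have : b + a ≠ 0 := by linarith
    rw [Real.cos_two_mul, hx, Real.cos_sq_arctan, Real.sq_sqrt hk]
    have e : 1 + (b - a) / (b + a) = 2 * b / (b + a) := by
      field_simp
      ring
    rw [e]
    field_simp
    ring
  rw [← Real.arccos_eq_pi_div_two_sub_arcsin, ← hc, Real.arccos_cos (by linarith) (by linarith)]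

/-- The integral `∫_0^∞ dt / (a + b cosh t)` in closed form. -/
lemma integral_inv_add_mul_cosh {a b : ℝ} (ha : 0 < a) (hab : a ≤ b) :
    ∫ t in Ioi (0 : ℝ), (a + b * Real.cosh t)⁻¹ = arcsinTerm a b := by
  have hb : 0 < b := ha.trans_le hab
  have hi := integrableOn_inv_add_mul_cosh ha.le hb
  rcases hab.lt_or_eq with h | rfl
  · set k := √((b - a) / (b + a)) with hk
    have hk2 : k ^ 2 = (b - a) / (b + a) :=
      Real.sq_sqrt (div_nonneg (by linarith) (by linarith))
    have hs : b * √(1 - (a / b) ^ 2) = k * (a + b) := by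
      have e1 : b = √(b ^ 2) := (Real.sqrt_sq hb.le).symm
      have e2 : a + b = √((a + b) ^ 2) := (Real.sqrt_sq (by linarith)).symm
      conv_lhs => rw [e1]
      conv_rhs => rw [e2]
      rw [hk, ← Real.sqrt_mul (by positivity),
        ← Real.sqrt_mul (div_nonneg (by linarith) (by linarith)), ← e1]
      congr 1
      have : b + a ≠ 0 := by linarith
      field_simp
      ring
    have hk0 : 0 < k := Real.sqrt_pos.2 (div_pos (by linarith) (by linarith))
    have hab0 : 0 < a + b := by linarith
    -- The antiderivative comes from the substitution `u = tanh (t/2)`, under which `a + b cosh t`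
    -- becomes `(a + b)(1 + k² u²)/(1 - u²)`.
    have key := integral_Ioi_of_hasDerivAt_of_tendsto (a := (0 : ℝ))
      (f := fun t => 2 / (k * (a + b)) * Real.arctan (k * Real.tanh (t / 2)))
      (f' := fun t => (a + b * Real.cosh t)⁻¹)
      (m := 2 / (k * (a + b)) * Real.arctan (k * 1)) ?_ ?_ hi ?_
    · rw [key, arcsinTerm, if_pos h, hs, ← two_mul_arctan_sqrt ha h, ← hk]
      simp
      ring
    · have h1 : ContinuousAt (fun t : ℝ => k * Real.tanh (t / 2)) 0 :=
        ((hasDerivAt_tanh_half 0).const_mul k).continuousAt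
      exact (continuousAt_const.mul (Real.continuous_arctan.continuousAt.comp h1)).continuousWithinAt
    · intro t _
      refine ((((hasDerivAt_tanh_half t).const_mul k).arctan).const_mul _).congr_deriv ?_
      have hc := Real.cosh_pos (t / 2)
      have hct := Real.cosh_pos t
      have h2 := cosh_half_sq t
      have h3 := Real.cosh_sq (t / 2)
      have e : (1 + (k * Real.tanh (t / 2)) ^ 2) * (2 * Real.cosh (t / 2) ^ 2) =
          2 * (a + b * Real.cosh t) / (a + b) := by
        rw [Real.tanh_eq_sinh_div_cosh, mul_pow, hk2, div_pow]
        have e4 : Real.sinh (t / 2) ^ 2 = (Real.cosh t - 1) / 2 := by linarith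
        rw [e4, h2]
        have : b + a ≠ 0 := by linarith
        have : Real.cosh t + 1 ≠ 0 := by linarith
        field_simp
        ring
      have e5 : 1 / (1 + (k * Real.tanh (t / 2)) ^ 2) * (k * (1 / (2 * Real.cosh (t / 2) ^ 2))) =
          k / ((1 + (k * Real.tanh (t / 2)) ^ 2) * (2 * Real.cosh (t / 2) ^ 2)) := by
        field_simp
      rw [e5, e]
      have : a + b * Real.cosh t ≠ 0 := by positivity
      field_simp
    · exact ((Real.continuous_arctan.tendsto _).comp
        (tendsto_tanh_half.const_mul k)).const_mul _
  · have key := integral_Ioi_of_hasDerivAt_of_tendsto (a := (0 : ℝ))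
      (f := fun t => 1 / a * Real.tanh (t / 2))
      (f' := fun t => (a + a * Real.cosh t)⁻¹) (m := 1 / a * 1)
      ((hasDerivAt_tanh_half 0).const_mul _).continuousAt.continuousWithinAt (fun t _ => ?_) hi
      (tendsto_tanh_half.const_mul _)
    · rw [key, arcsinTerm, if_neg (lt_irrefl a)]
      simp
    · refine ((hasDerivAt_tanh_half t).const_mul _).congr_deriv ?_
      rw [cosh_half_sq]
      have hct := Real.cosh_pos t
      have : 1 + Real.cosh t ≠ 0 := by positivity
      have : Real.cosh t + 1 ≠ 0 := by positivity
      have : a + a * Real.cosh t ≠ 0 := by positivity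
      field_simp
      ring

/-! ### The Bessel sum as an integral. -/

lemma hasSum_integral_of_summable_mul {E : Type*} [NormedAddCommGroup E] [NormedSpace ℝ E]
    {f : ℕ → ℝ → E} {c : ℕ → ℝ} {w : ℝ → ℝ} (hc : Summable c)
    (hw : IntegrableOn w (Ioi 0))
    (hf : ∀ m, AEStronglyMeasurable (f m) (volume.restrict (Ioi 0)))
    (hle : ∀ m, ∀ t, 0 < t → ‖f m t‖ ≤ c m * w t) {g : ℝ → E}
    (hg : ∀ t, 0 < t → HasSum (fun m => f m t) (g t)) :
    HasSum (fun m => ∫ t in Ioi (0 : ℝ), f m t) (∫ t in Ioi (0 : ℝ), g t) := by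
  have hle' : ∀ m, ∀ᵐ t ∂(volume.restrict (Ioi (0 : ℝ))), ‖f m t‖ ≤ c m * w t := fun m =>
    (ae_restrict_iff' measurableSet_Ioi).2 (ae_of_all _ fun t ht => hle m t ht)
  have hi : ∀ m, Integrable (f m) (volume.restrict (Ioi (0 : ℝ))) := fun m =>
    Integrable.mono' (hw.const_mul (c m)) (hf m) (hle' m)
  have hs : Summable fun m => ∫ t in Ioi (0 : ℝ), ‖f m t‖ := by
    refine Summable.of_nonneg_of_le (fun m => integral_nonneg fun t => norm_nonneg _)
      (fun m => (integral_mono_ae (hi m).norm (hw.const_mul (c m)) (hle' m)).trans_eq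
        (integral_const_mul _ _)) (hc.mul_right _)
  have h := hasSum_integral_of_summable_integral_norm hi hs
  rwa [setIntegral_congr_fun measurableSet_Ioi fun t ht => (hg t ht).tsum_eq] at h

lemma integrableOn_exp_neg_mul_cosh {b : ℝ} (hb : 0 < b) :
    IntegrableOn (fun t => Real.exp (-b * Real.cosh t)) (Ioi 0) := by
  refine Integrable.mono' (integrableOn_inv_add_mul_cosh le_rfl hb) (by fun_prop)
    (ae_of_all _ fun t => ?_)
  have hx : 0 < b * Real.cosh t := mul_pos hb (Real.cosh_pos t)
  rw [Real.norm_of_nonneg (Real.exp_pos _).le, zero_add, neg_mul, Real.exp_neg]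
  gcongr
  linarith [Real.add_one_le_exp (b * Real.cosh t)]

/-- `∑_{n ≥ 1} e^{-an} K_0(bn) = ∫_0^∞ dt / (e^{a + b cosh t} - 1)`. -/
lemma hasSum_exp_mul_besselK {a b : ℝ} (ha : 0 < a) (hb : 0 < b) :
    HasSum (fun n : ℕ => Real.exp (-a * ((n : ℝ) + 1)) * besselK 0 (b * ((n : ℝ) + 1)))
      (∫ t in Ioi (0 : ℝ), (Real.exp (a + b * Real.cosh t) - 1)⁻¹) := by
  have hq : |Real.exp (-a)| < 1 := by
    rw [abs_of_pos (Real.exp_pos _), Real.exp_lt_one_iff]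
    linarith
  have h := hasSum_integral_of_summable_mul
    (f := fun (n : ℕ) t => Real.exp (-((n : ℝ) + 1) * (a + b * Real.cosh t)))
    (c := fun n => Real.exp (-a) ^ n) (w := fun t => Real.exp (-b * Real.cosh t))
    (g := fun t => (Real.exp (a + b * Real.cosh t) - 1)⁻¹)
    (summable_geometric_of_abs_lt_one hq) (integrableOn_exp_neg_mul_cosh hb)
    (fun m => by fun_prop) (fun m t _ => ?_) (fun t _ => ?_)
  · refine h.congr_fun fun n => ?_
    rw [besselK, ← integral_const_mul]
    refine setIntegral_congr_fun measurableSet_Ioi fun t _ => ?_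
    simp only [zero_mul, Real.cosh_zero, mul_one]
    rw [← Real.exp_add]
    congr 1
    ring
  · rw [Real.norm_of_nonneg (Real.exp_pos _).le, ← Real.exp_nat_mul, ← Real.exp_add]
    refine Real.exp_le_exp.2 ?_
    have : 0 < b * Real.cosh t := mul_pos hb (Real.cosh_pos t)
    nlinarith [m.cast_nonneg (α := ℝ)]
  · have hu : 0 < a + b * Real.cosh t := by
      have := Real.cosh_pos t
      positivity
    set u := a + b * Real.cosh t
    have hq : |Real.exp (-u)| < 1 := by
      rw [abs_of_pos (Real.exp_pos _), Real.exp_lt_one_iff]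
      linarith
    have h := (hasSum_geometric_of_abs_lt_one hq).mul_right (Real.exp (-u))
    have h1 : 1 < Real.exp u := Real.one_lt_exp_iff.2 hu
    have e : (1 - Real.exp (-u))⁻¹ * Real.exp (-u) = (Real.exp u - 1)⁻¹ := by
      rw [Real.exp_neg]
      have h2 : Real.exp u - 1 ≠ 0 := by linarith
      have h3 : 1 - (Real.exp u)⁻¹ = (Real.exp u - 1) / Real.exp u := by field_simp
      rw [h3]
      field_simp
    rw [e] at h
    refine h.congr_fun fun n => ?_
    rw [← Real.exp_nat_mul, ← Real.exp_add]
    congr 1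
    ring

lemma integrableOn_inv_exp_sub_one {a b : ℝ} (ha : 0 < a) (hb : 0 < b) :
    IntegrableOn (fun t => (Real.exp (a + b * Real.cosh t) - 1)⁻¹) (Ioi 0) := by
  have hp : ∀ t, 0 < a + b * Real.cosh t := fun t => by
    have := Real.cosh_pos t
    positivity
  have hq : ∀ t, a + b * Real.cosh t ≤ Real.exp (a + b * Real.cosh t) - 1 := fun t => by
    linarith [Real.add_one_le_exp (a + b * Real.cosh t)]
  refine Integrable.mono' (integrableOn_inv_add_mul_cosh ha.le hb)
    (Continuous.inv₀ (by fun_prop) fun t => ((hp t).trans_le (hq t)).ne').aestronglyMeasurable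
    (ae_of_all _ fun t => ?_)
  rw [Real.norm_of_nonneg (inv_nonneg.2 ((hp t).trans_le (hq t)).le)]
  exact inv_anti₀ (hp t) (hq t)

lemma coshMoment_planckReg_eq {a b : ℝ} (ha : 0 < a) (hab : a ≤ b) :
    coshMoment 0 (fun x => iteratedDeriv 0 planckReg ((a + x : ℝ) : ℂ)) b =
      ((∑' n : ℕ, Real.exp (-a * ((n : ℝ) + 1)) * besselK 0 (b * ((n : ℝ) + 1)) : ℝ) : ℂ) -
        ((arcsinTerm a b : ℝ) : ℂ) := by
  have hb := ha.trans_le hab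
  rw [(hasSum_exp_mul_besselK ha hb).tsum_eq, ← integral_inv_add_mul_cosh ha hab,
    ← Complex.ofReal_sub, ← integral_sub (integrableOn_inv_exp_sub_one ha hb)
      (integrableOn_inv_add_mul_cosh ha.le hb), ← integral_complex_ofReal, coshMoment]
  refine setIntegral_congr_fun measurableSet_Ioi fun t _ => ?_
  have hu : 0 < a + b * Real.cosh t := by
    have := Real.cosh_pos t
    positivity
  simp only [pow_zero, one_smul, iteratedDeriv_zero]
  rw [planckReg_eq (by exact_mod_cast hu.ne') (exp_ne_one_of_pos hu), planck]
  push_cast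
  rfl

/-! ### Identification of the terms and the convergence majorants. -/

lemma digamma_natCast_add_one (n : ℕ) :
    Complex.digamma ((n : ℂ) + 1) = (harmonic n : ℂ) - Real.eulerMascheroniConstant := by
  have hf : (n.factorial : ℂ) ≠ 0 := by exact_mod_cast n.factorial_ne_zero
  rw [Complex.digamma_def, logDeriv_apply, (Complex.hasDerivAt_Gamma_nat n).deriv,
    Complex.Gamma_nat_eq_factorial]
  field_simp
  ring

/-- The `-γ` from the logarithmic integral combines with `H_n` into `ψ(n + 1)`, and the sign
`(-1)^(m+2n)` is `(-1)^m`. -/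
lemma doubleTerm_eq (a b : ℝ) (m n : ℕ) :
    doubleTerm a b m n = (a : ℂ) ^ m / (m.factorial : ℂ) *
      frobTerm (iteratedDeriv (m + 2 * n) planckReg (0 : ℝ))
        (-∫ y in Ioi (0 : ℝ), iteratedDeriv (m + 2 * n + 1) planckReg y * (Real.log y : ℂ)) n b := by
  have hs : ((-1 : ℂ)) ^ (m + 2 * n) = (-1) ^ m := by simp [pow_add, pow_mul]
  have he : -2 * (n : ℂ) - (m : ℂ) = -((m + 2 * n : ℕ) : ℂ) := by
    push_cast
    ring
  rw [neg_integral_iteratedDeriv_planckReg_mul_log, Complex.ofReal_zero,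
    iteratedDeriv_planckReg_zero, doubleTerm, frobTerm, hs, he, digamma_natCast_add_one]
  push_cast
  ring

/-- With Cauchy bounds of size `k!/r^k`, this makes the `n`-th Frobenius remainder of order `(2n +
1)(x/r)^(2n)`, so the expansion converges for `x < r`. -/
lemma factorial_two_mul_le (n : ℕ) : (2 * n).factorial ≤ (2 * n + 1) * oddProd n ^ 2 := by
  induction n with
  | zero => simp [oddProd]
  | succ n ih =>
    rw [show 2 * (n + 1) = 2 * n + 1 + 1 by ring, Nat.factorial_succ, Nat.factorial_succ,
      oddProd_succ]
    calc (2 * n + 1 + 1) * ((2 * n + 1) * (2 * n).factorial)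
        ≤ (2 * n + 1 + 1) * ((2 * n + 1) * ((2 * n + 1) * oddProd n ^ 2)) := by gcongr
      _ = (2 * n + 1 + 1) * (oddProd n * (2 * n + 1)) ^ 2 := by ring
      _ ≤ _ := by
        gcongr
        omega

/-- Summing first over the index of `α` gives `(1 - α)^{-(j+1)}`. What remains is a series in `ρ/(1
- α)`, which is less than `1`. -/
lemma summable_succ_mul_choose_mul_pow {α ρ : ℝ} (hα : 0 ≤ α) (hρ : 0 ≤ ρ) (h : α + ρ < 1) :
    Summable fun p : ℕ × ℕ =>
      ((p.2 : ℝ) + 1) * ((p.1 + p.2).choose p.2 : ℝ) * α ^ p.1 * ρ ^ p.2 := by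
  have hα1 : ‖α‖ < 1 := by
    rw [Real.norm_of_nonneg hα]
    linarith
  have h1α : 0 < 1 - α := by linarith
  rw [← (Equiv.prodComm ℕ ℕ).summable_iff]
  refine (summable_prod_of_nonneg fun p => ?_).2 ⟨fun j => ?_, ?_⟩
  · simp only [Function.comp, Pi.zero_apply]
    positivity
  · refine ((summable_choose_mul_geometric_of_norm_lt_one j hα1).mul_left
      (((j : ℝ) + 1) * ρ ^ j)).congr fun m => ?_
    simp only [Function.comp, Equiv.prodComm_apply, Prod.swap_prod_mk]
    ring
  · have e : ∀ j : ℕ, ∑' m : ℕ, ((fun p : ℕ × ℕ =>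
        ((p.2 : ℝ) + 1) * ((p.1 + p.2).choose p.2 : ℝ) * α ^ p.1 * ρ ^ p.2) ∘
          (Equiv.prodComm ℕ ℕ)) (j, m) =
        (1 - α)⁻¹ * (((j : ℝ) ^ 1 * (ρ / (1 - α)) ^ j) + (ρ / (1 - α)) ^ j) := fun j => by
      have h0 := tsum_choose_mul_geometric_of_norm_lt_one j hα1
      calc _ = ∑' m : ℕ, (((j : ℝ) + 1) * ρ ^ j) * (((m + j).choose j : ℝ) * α ^ m) := by
            refine tsum_congr fun m => ?_
            simp only [Function.comp, Equiv.prodComm_apply, Prod.swap_prod_mk]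
            ring
        _ = _ := by
            rw [tsum_mul_left, h0, div_pow, pow_succ]
            field_simp
    simp only [e]
    have hq : ‖ρ / (1 - α)‖ < 1 := by
      rw [Real.norm_of_nonneg (by positivity), div_lt_one h1α]
      linarith
    exact ((summable_pow_mul_geometric_of_norm_lt_one 1 hq).add
      (summable_geometric_of_norm_lt_one hq)).mul_left _

/-- Writing `(m + 2n)!` as a binomial coefficient times `m! (2n)!` bounds the array by the
even-indexed part of the binomial series in `a/r` and `b/r`. -/
lemma summable_factorial_div_oddProd_prod {a b r : ℝ} (ha : 0 ≤ a) (hb : 0 ≤ b)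
    (h : a + b < r) :
    Summable fun p : ℕ × ℕ => a ^ p.1 / (p.1.factorial : ℝ) *
      (((p.1 + 2 * p.2).factorial : ℝ) / r ^ (p.1 + 2 * p.2) / (oddProd p.2 : ℝ) ^ 2 *
        b ^ (2 * p.2)) := by
  have hr : 0 < r := by linarith
  have hs := summable_succ_mul_choose_mul_pow (div_nonneg ha hr.le) (div_nonneg hb hr.le)
    (by rw [← add_div, div_lt_one hr]; exact h)
  have hinj : Function.Injective fun p : ℕ × ℕ => (p.1, 2 * p.2) := fun p q hpq => by
    simp only [Prod.mk.injEq] at hpq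
    exact Prod.ext hpq.1 (by omega)
  refine Summable.of_nonneg_of_le (fun p => by positivity) (fun p => ?_) (hs.comp_injective hinj)
  obtain ⟨m, n⟩ := p
  simp only [Function.comp]
  have h1 : ((m + 2 * n).factorial : ℝ) =
      ((m + 2 * n).choose (2 * n) : ℝ) * m.factorial * (2 * n).factorial := by
    exact_mod_cast (Nat.add_choose_mul_factorial_mul_factorial m (2 * n)).symm
  have h2 : ((2 * n).factorial : ℝ) ≤ ((2 * n : ℕ) + 1) * (oddProd n : ℝ) ^ 2 := by
    exact_mod_cast factorial_two_mul_le n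
  have h3 : (0 : ℝ) < oddProd n := by exact_mod_cast oddProd_pos n
  have h4 : (0 : ℝ) < m.factorial := by exact_mod_cast m.factorial_pos
  calc a ^ m / (m.factorial : ℝ) * (((m + 2 * n).factorial : ℝ) / r ^ (m + 2 * n) /
        (oddProd n : ℝ) ^ 2 * b ^ (2 * n))
      = ((2 * n).factorial / (oddProd n : ℝ) ^ 2) * ((m + 2 * n).choose (2 * n) : ℝ) *
        (a / r) ^ m * (b / r) ^ (2 * n) := by
        rw [h1, pow_add, div_pow, div_pow]
        field_simp
    _ ≤ _ := by
        gcongr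
        rwa [div_le_iff₀ (by positivity)]

lemma summable_factorial_div_oddProd (m : ℕ) {b r : ℝ} (hb : 0 ≤ b) (h : b < r) :
    Summable fun n : ℕ => ((m + 2 * n).factorial : ℝ) / r ^ (m + 2 * n) /
      (oddProd n : ℝ) ^ 2 * b ^ (2 * n) := by
  -- Any positive value below `r - b` serves as auxiliary first variable; the single series is one
  -- row of the double one.
  have ha : 0 < (r - b) / 2 := by linarith
  have := (summable_factorial_div_oddProd_prod ha.le hb (by linarith : (r - b) / 2 + b < r)).prod_factor m
  refine (this.mul_left (((r - b) / 2) ^ m / (m.factorial : ℝ))⁻¹).congr fun n => ?_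
  have h4 : (0 : ℝ) < m.factorial := by exact_mod_cast m.factorial_pos
  rw [inv_mul_cancel_left₀ (by positivity)]

lemma exists_common_bound_planckReg {r : ℝ} (hr : 0 < r) (hr' : r < 2 * Real.pi) :
    ∃ C, 0 ≤ C ∧ ∀ (k : ℕ) (x : ℝ), 0 < x →
      ‖iteratedDeriv k planckReg x‖ ≤ C * ((k.factorial : ℝ) / r ^ k) / x := by
  obtain ⟨C, hC, h⟩ := norm_iteratedDeriv_planckReg_le hr hr' 0
  refine ⟨C, hC, fun k x hx => (h k x (Nat.zero_le k) hx.le).trans ?_⟩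
  rw [zero_add, pow_one, mul_div_assoc]
  gcongr
  linarith

lemma iteratedDeriv_planckReg_decay (m : ℕ) {c : ℝ} (hc : 0 ≤ c) (e k : ℕ) (hek : e ≤ k) :
    ∃ C, ∀ x : ℝ, 0 < x →
      ‖iteratedDeriv (m + k) planckReg ((c + x : ℝ) : ℂ)‖ ≤ C / (1 + x) ^ (e + 1) := by
  obtain ⟨C, hC, h⟩ := exists_norm_iteratedDeriv_planckReg_le e (m + k) (by omega)
  refine ⟨C, fun x hx => (h (c + x) (by linarith)).trans ?_⟩
  gcongr
  linarith

/-! ### The two iterated expansions and the joint summability. -/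

lemma hasDerivAt_iteratedDeriv_planckReg_const_add (k : ℕ) (c x : ℝ) :
    HasDerivAt (fun x : ℝ => iteratedDeriv k planckReg ((c + x : ℝ) : ℂ))
      (iteratedDeriv (k + 1) planckReg ((c + x : ℝ) : ℂ)) x :=
  (hasDerivAt_iteratedDeriv_planckReg k (c + x)).comp_const_add c x

lemma hasSum_doubleTerm_right (a : ℝ) {b : ℝ} (hb : 0 < b) (hb2 : b < 2 * Real.pi) (m : ℕ) :
    HasSum (fun n => doubleTerm a b m n) ((a : ℂ) ^ m / (m.factorial : ℂ) *
      coshMoment 0 (fun x => iteratedDeriv m planckReg x) b) := by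
  obtain ⟨r, hbr, hr⟩ := exists_between hb2
  have hr0 := hb.trans hbr
  obtain ⟨C, hC, h⟩ := exists_common_bound_planckReg hr0 hr
  have := hasSum_frobTerm (F := fun k x => iteratedDeriv (m + k) planckReg (x : ℂ))
    (M := fun k => C * (((m + k).factorial : ℝ) / r ^ (m + k)))
    (fun k x _ => hasDerivAt_iteratedDeriv_planckReg (m + k) x)
    (fun e k hek => by simpa using iteratedDeriv_planckReg_decay m le_rfl e k hek)
    (fun k x hx => h (m + k) x hx) hb (by
      simpa only [mul_div_assoc, mul_assoc] using
        (summable_factorial_div_oddProd m hb.le hbr).mul_left C)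
  refine (this.mul_left ((a : ℂ) ^ m / (m.factorial : ℂ))).congr_fun fun n => ?_
  exact doubleTerm_eq a b m n

lemma norm_pow_div_factorial_mul_le {a r C : ℝ} (ha : 0 ≤ a) (hr : 0 < r) (k m : ℕ) {z : ℂ}
    {w : ℝ} (hz : ‖z‖ ≤ C * ((k + m).factorial : ℝ) / r ^ (k + m) * w) :
    ‖(a : ℂ) ^ m / (m.factorial : ℂ) * z‖ ≤
      (C * k.factorial / r ^ k * (((m + k).choose k : ℝ) * (a / r) ^ m)) * w := by
  have h4 : (0 : ℝ) < m.factorial := by exact_mod_cast m.factorial_pos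
  have h1 : ((k + m).factorial : ℝ) = ((m + k).choose k : ℝ) * m.factorial * k.factorial := by
    rw [add_comm k m]
    exact_mod_cast (Nat.add_choose_mul_factorial_mul_factorial m k).symm
  rw [norm_mul, norm_div, norm_pow, Complex.norm_real, Real.norm_of_nonneg ha,
    Complex.norm_natCast]
  calc a ^ m / (m.factorial : ℝ) * ‖z‖
      ≤ a ^ m / (m.factorial : ℝ) * (C * ((k + m).factorial : ℝ) / r ^ (k + m) * w) := by gcongr
    _ = _ := by
      rw [h1, pow_add, div_pow]
      field_simp

lemma summable_choose_mul_div_pow (D : ℝ) (k : ℕ) {a r : ℝ} (ha : 0 ≤ a) (har : a < r) :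
    Summable fun m : ℕ => D * (((m + k).choose k : ℝ) * (a / r) ^ m) := by
  have hr : 0 < r := ha.trans_lt har
  refine (summable_choose_mul_geometric_of_norm_lt_one k ?_).mul_left D
  rwa [Real.norm_of_nonneg (by positivity), div_lt_one hr]

lemma hasSum_coshMoment_taylor {a b : ℝ} (ha : 0 < a) (ha2 : a < 2 * Real.pi) (hb : 0 < b) :
    HasSum (fun m : ℕ => (a : ℂ) ^ m / (m.factorial : ℂ) *
        coshMoment 0 (fun x => iteratedDeriv m planckReg x) b)
      (coshMoment 0 (fun x => iteratedDeriv 0 planckReg ((a + x : ℝ) : ℂ)) b) := by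
  obtain ⟨r, har, hr⟩ := exists_between ha2
  have hr0 := ha.trans har
  obtain ⟨C, hC, h⟩ := norm_iteratedDeriv_planckReg_le hr0 hr 0
  have key := hasSum_integral_of_summable_mul
    (f := fun (m : ℕ) (t : ℝ) => (a : ℂ) ^ m / (m.factorial : ℂ) *
      iteratedDeriv (0 + m) planckReg ((b * Real.cosh t : ℝ) : ℂ))
    (g := fun t => iteratedDeriv 0 planckReg ((a + b * Real.cosh t : ℝ) : ℂ))
    (summable_choose_mul_div_pow (C * (0 : ℕ).factorial / r ^ 0) 0 ha.le har)
    (integrableOn_inv_add_mul_cosh zero_le_one hb) (fun m => ?_) (fun m t _ => ?_)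
    (fun t _ => hasSum_taylor_planckReg 0 (b * Real.cosh t) (by rwa [abs_of_pos ha]))
  · simp only [zero_add, integral_const_mul] at key
    simpa only [coshMoment, pow_zero, one_smul] using key
  · refine Continuous.aestronglyMeasurable (continuous_const.mul ?_)
    exact (continuous_iteratedDeriv_planckReg (0 + m)).comp (by fun_prop)
  · refine norm_pow_div_factorial_mul_le ha.le hr0 0 m ?_
    refine (h (0 + m) _ (Nat.zero_le _) (mul_pos hb (Real.cosh_pos t)).le).trans_eq ?_
    rw [zero_add 1, pow_one, div_eq_mul_inv]

/-- With `k ≥ 1` every derivative involved decays like `(1 + y)^{-2}`, which is integrable against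
`|log y|`; this legitimates integrating the Taylor series termwise. -/
lemma hasSum_integral_mul_log_taylor {a : ℝ} (ha : 0 < a) (ha2 : a < 2 * Real.pi) (k : ℕ)
    (hk : 1 ≤ k) :
    HasSum (fun m : ℕ => (a : ℂ) ^ m / (m.factorial : ℂ) *
        ∫ y in Ioi (0 : ℝ), iteratedDeriv (k + m) planckReg y * (Real.log y : ℂ))
      (∫ y in Ioi (0 : ℝ), iteratedDeriv k planckReg ((a + y : ℝ) : ℂ) * (Real.log y : ℂ)) := by
  obtain ⟨r, har, hr⟩ := exists_between ha2
  have hr0 := ha.trans har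
  obtain ⟨C, hC, h⟩ := norm_iteratedDeriv_planckReg_le hr0 hr 1
  have key := hasSum_integral_of_summable_mul
    (f := fun (m : ℕ) (y : ℝ) => (a : ℂ) ^ m / (m.factorial : ℂ) *
      (iteratedDeriv (k + m) planckReg y * (Real.log y : ℂ)))
    (g := fun y => iteratedDeriv k planckReg ((a + y : ℝ) : ℂ) * (Real.log y : ℂ))
    (summable_choose_mul_div_pow (C * k.factorial / r ^ k) k ha.le har)
    integrableOn_abs_log_div_one_add_sq (fun m => ?_) (fun m y hy => ?_) (fun y _ => ?_)
  · simpa only [integral_const_mul] using key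
  · refine AEStronglyMeasurable.const_mul ?_ _
    exact (continuous_iteratedDeriv_planckReg (k + m)).aestronglyMeasurable.mul
      (Complex.measurable_ofReal.comp Real.measurable_log).aestronglyMeasurable
  · refine norm_pow_div_factorial_mul_le ha.le hr0 k m ?_
    rw [norm_mul, Complex.norm_real, Real.norm_eq_abs]
    calc _ ≤ C * ((k + m).factorial : ℝ) / r ^ (k + m) / (1 + y) ^ (1 + 1) * |Real.log y| := by
          gcongr
          exact h (k + m) y (by omega) hy.le
      _ = _ := by ring
  · have := (hasSum_taylor_planckReg k y (s := a) (by rwa [abs_of_pos ha])).mul_right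
      (Real.log y : ℂ)
    simpa only [mul_assoc] using this

lemma hasSum_doubleTerm_left {a : ℝ} (ha : 0 < a) (ha2 : a < 2 * Real.pi) (b : ℝ) (n : ℕ) :
    HasSum (fun m => doubleTerm a b m n)
      (frobTerm (iteratedDeriv (2 * n) planckReg ((a + 0 : ℝ) : ℂ))
        (-∫ y in Ioi (0 : ℝ), iteratedDeriv (2 * n + 1) planckReg ((a + y : ℝ) : ℂ) *
          (Real.log y : ℂ)) n b) := by
  have h0 := hasSum_taylor_planckReg (2 * n) 0 (s := a) (by rwa [abs_of_pos ha])
  have h1 := (hasSum_integral_mul_log_taylor ha ha2 (2 * n + 1) (by omega)).neg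
  have := ((h0.mul_right (((harmonic n : ℝ) - Real.log (b / 2) : ℝ) : ℂ)).add h1).mul_left
    ((((b / 2) ^ (2 * n) / (n.factorial : ℝ) ^ 2 : ℝ) : ℂ))
  refine this.congr_fun fun m => ?_
  rw [doubleTerm_eq, frobTerm, add_comm m (2 * n), show 2 * n + m + 1 = 2 * n + 1 + m by ring]
  ring

/-- The Cauchy bounds hold at every nonnegative point, so translating by `a` does not shrink the
radius: only `b < 2π` is needed. -/
lemma hasSum_frobTerm_shift {a b : ℝ} (ha : 0 < a) (hb : 0 < b) (hb2 : b < 2 * Real.pi) :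
    HasSum (fun n : ℕ => frobTerm (iteratedDeriv (2 * n) planckReg ((a + 0 : ℝ) : ℂ))
        (-∫ y in Ioi (0 : ℝ), iteratedDeriv (2 * n + 1) planckReg ((a + y : ℝ) : ℂ) *
          (Real.log y : ℂ)) n b)
      (coshMoment 0 (fun x => iteratedDeriv 0 planckReg ((a + x : ℝ) : ℂ)) b) := by
  obtain ⟨r, hbr, hr⟩ := exists_between hb2
  have hr0 := hb.trans hbr
  obtain ⟨C, hC, h⟩ := exists_common_bound_planckReg hr0 hr
  exact hasSum_frobTerm (F := fun k x => iteratedDeriv k planckReg ((a + x : ℝ) : ℂ))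
    (M := fun k => C * ((k.factorial : ℝ) / r ^ k))
    (fun k x _ => hasDerivAt_iteratedDeriv_planckReg_const_add k a x)
    (fun e k hek => by simpa using iteratedDeriv_planckReg_decay 0 ha.le e k hek)
    (fun k x hx => (h k (a + x) (by linarith)).trans (by gcongr; linarith)) hb (by
      simpa only [zero_add, mul_div_assoc, mul_assoc] using
        (summable_factorial_div_oddProd 0 hb.le hbr).mul_left C)

/-- Each term is bounded by two consecutive remainder bounds, so the family is dominated by the
majorant array plus its shift in `n`. -/
lemma summable_doubleTerm_prod {a b : ℝ} (ha : 0 < a) (hb : 0 < b) (hab : a + b < 2 * Real.pi) :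
    Summable fun p : ℕ × ℕ => doubleTerm a b p.1 p.2 := by
  obtain ⟨r, hr1, hr⟩ := exists_between hab
  have hr0 : 0 < r := by linarith
  obtain ⟨C, hC, h⟩ := exists_common_bound_planckReg hr0 hr
  have hs := (summable_factorial_div_oddProd_prod ha.le hb.le hr1).mul_left (2 * C)
  have hinj : Function.Injective fun p : ℕ × ℕ => (p.1, p.2 + 1) := fun p q hpq => by
    simp only [Prod.mk.injEq] at hpq
    exact Prod.ext hpq.1 (by omega)
  refine Summable.of_norm_bounded ((hs.add (hs.comp_injective hinj)).mul_left b⁻¹) fun p => ?_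
  obtain ⟨m, n⟩ := p
  have hk := mul_norm_frobTerm_le (F := fun k x => iteratedDeriv k planckReg (x : ℂ))
    (M := fun k => C * ((k.factorial : ℝ) / r ^ k))
    (fun k x _ => hasDerivAt_iteratedDeriv_planckReg k x)
    (fun e k hek => by simpa using iteratedDeriv_planckReg_decay 0 le_rfl e k hek) h m n hb
  rw [le_inv_mul_iff₀ hb, doubleTerm_eq, norm_mul, norm_div, norm_pow, Complex.norm_real,
    Real.norm_of_nonneg ha.le, Complex.norm_natCast, mul_left_comm]
  refine (mul_le_mul_of_nonneg_left hk (by positivity)).trans_eq ?_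
  simp only [Function.comp]
  ring

theorem mainTheorem4 (a b : ℝ) (ha : 0 < a) (hab : a ≤ b)
    (ha2 : a < 2 * Real.pi) (hb2 : b < 2 * Real.pi) :
    -- the Bessel sum (over `n + 1 ≥ 1`) converges
    Summable (fun n : ℕ => Real.exp (-a * ((n : ℝ) + 1)) * besselK 0 (b * ((n : ℝ) + 1))) ∧
    -- the double series, summed first over `n` and then over `m`
    ((∀ m : ℕ, Summable (fun n : ℕ => doubleTerm a b m n)) ∧
      Summable (fun m : ℕ => ∑' n : ℕ, doubleTerm a b m n) ∧
      ((∑' n : ℕ, Real.exp (-a * ((n : ℝ) + 1)) * besselK 0 (b * ((n : ℝ) + 1)) : ℝ) : ℂ) =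
        (∑' m : ℕ, ∑' n : ℕ, doubleTerm a b m n) + ((arcsinTerm a b : ℝ) : ℂ)) ∧
    -- the double series, summed first over `m` and then over `n`
    ((∀ n : ℕ, Summable (fun m : ℕ => doubleTerm a b m n)) ∧
      Summable (fun n : ℕ => ∑' m : ℕ, doubleTerm a b m n) ∧
      ((∑' n : ℕ, Real.exp (-a * ((n : ℝ) + 1)) * besselK 0 (b * ((n : ℝ) + 1)) : ℝ) : ℂ) =
        (∑' n : ℕ, ∑' m : ℕ, doubleTerm a b m n) + ((arcsinTerm a b : ℝ) : ℂ)) ∧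
    -- the double series as an absolutely convergent series over all pairs `(m, n)`
    (a + b < 2 * Real.pi →
      Summable (fun p : ℕ × ℕ => doubleTerm a b p.1 p.2) ∧
      ((∑' n : ℕ, Real.exp (-a * ((n : ℝ) + 1)) * besselK 0 (b * ((n : ℝ) + 1)) : ℝ) : ℂ) =
        (∑' p : ℕ × ℕ, doubleTerm a b p.1 p.2) + ((arcsinTerm a b : ℝ) : ℂ)) := by
  have hb := ha.trans_le hab
  have hI := coshMoment_planckReg_eq ha hab
  have r1 := hasSum_doubleTerm_right a hb hb2
  have r2 := hasSum_coshMoment_taylor ha ha2 hb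
  have l1 := hasSum_doubleTerm_left ha ha2 b
  have l2 := hasSum_frobTerm_shift ha hb hb2
  simp only [← fun m => (r1 m).tsum_eq] at r2
  simp only [← fun n => (l1 n).tsum_eq] at l2
  rw [hI] at r2 l2
  refine ⟨(hasSum_exp_mul_besselK ha hb).summable,
    ⟨fun m => (r1 m).summable, r2.summable, ?_⟩,
    ⟨fun n => (l1 n).summable, l2.summable, ?_⟩, fun h => ?_⟩
  · rw [r2.tsum_eq, sub_add_cancel]
  · rw [l2.tsum_eq, sub_add_cancel]
  · have hs := summable_doubleTerm_prod ha hb h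
    refine ⟨hs, ?_⟩
    rw [hs.tsum_prod, r2.tsum_eq, sub_add_cancel]
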